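/- Let $n\ge 1$ and let $Y_i=\theta_i+\epsilon_i$, $i=1,\dots,n$, where $\theta\in\mathbb{R}^n$ and $\epsilon_1,\dots,\epsilon_n$ are independent mean-zero random variables with $\mathbb{E}[e^{t\epsilon_i}]\le e^{t^2/2}$ for all $t\in\mathbb{R}$. Notation. A change-point vector is a finite (possibly empty) sequence of integers $\tau=(\tau_1<\dots<\tau_m)$ in $\{2,\dots,n\}$; we write $|\tau|=m$, $\{\tau\}$ for its set of entries, and use the conventions $\tau_0=1$, $\tau_{m+1}=n+1$. Let $\Pi_\tau$ be the orthogonal projector of $\mathbb{R}^n$ onto the vectors that are constant on each $\{\tau_i,\dots,\tau_{i+1}-1\}$, $0\le i\le m$. For $L>1$ and $q>0$, a penalized least-squares estimator $\widehat\tau$ is any minimizer over all change-point vectors $\tau$ of $$\|Y-\Pi_\tau Y\|^2+L\Big[q|\tau|+2\sum_{i=1}^{|\tau|+1}\log\Big(\frac{n}{\tau_i-\tau_{i-1}}\Big)\Big].$$ Let $\tau^*=(\tau^*_1<\dots<\tau^*_K)$ be the positions $t\in\{2,\dots,n\}$ with $\theta_{t-1}\ne\theta_t$ (with $\tau^*_0=1$,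 $\tau^*_{K+1}=n+1$), and $\Delta_k=\theta_{\tau^*_k}-\theta_{\tau^*_k-1}$. For integers $1\le t_1<t_2<t_3\le n+1$ put $$E(t_1,t_2,t_3)=\Big|\frac{\sum_{i=t_2}^{t_3-1}\theta_i}{t_3-t_2}-\frac{\sum_{i=t_1}^{t_2-1}\theta_i}{t_2-t_1}\Big|\sqrt{\frac{(t_2-t_1)(t_3-t_2)}{t_3-t_1}}.$$ An entry $\tau_l$ of $\tau$ is a $(\kappa,q,\tau)$-high-energy change-point if $$E(\tau_{l-1},\tau_l,\tau_{l+1})>\kappa\sqrt{2\log\Big(\frac{n(\tau_{l+1}-\tau_{l-1})}{(\tau_{l+1}-\tau_l)(\tau_l-\tau_{l-1})}\Big)+q};$$ $(\kappa,q)$-high-energy means $(\kappa,q,\tau^*)$-high-energy. Let $\widehat\tau^{(k)}$ be $\widehat\tau$ with the entry $\tau^*_k$ inserted, and $d_{H,1}(\tau,t)=\min_i|\tau_i-t|$ ($=+\infty$ if $\tau$ is empty). Proposition. There are universal constants $q'_0,c_1,c_2>0$ and, for every $L>1$, constants $\kappa_L>1$ and $\eta_L\in(0,1)$ depending only on $L$,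 such that the following holds for every $L>1$, every $q>q'_0+c_1\log[((L\wedge 2)-1)^{-1}]$, every $n\ge 1$ and every noise vector $\epsilon$ as above. There is an event $\mathcal{A}_{L,q}$, not depending on $\theta$, of probability at least $1-c_1e^{-c_2q}$, on which, for every $\theta\in\mathbb{R}^n$, every penalized least-squares estimator $\widehat\tau$ satisfies: (a) for all $k=0,\dots,K$, $\ |\{\widehat\tau\}\cap[\tau^*_k,\tau^*_{k+1})|\le 2$, $\ |\{\widehat\tau\}\cap[\tau^*_k,\tau^*_k+\eta_L(\tau^*_{k+1}-\tau^*_k)]|\le 1$ and $|\{\widehat\tau\}\cap[\tau^*_{k+1}-\eta_L(\tau^*_{k+1}-\tau^*_k),\tau^*_{k+1}]|\le 1$; (b) for all $k\in\{1,\dots,K\}$ such that $\tau^*_k$ is a $(\kappa_L,q)$-high-energy change-point, $$d_{H,1}(\widehat\tau,\tau^*_k)\le\min\Big\{\frac{\tau^*_{k+1}-\tau^*_k}{2},\ \frac{\tau^*_k-\tau^*_{k-1}}{2},\ \kappa_L\frac{\log(n\Delta_k^2)+q}{\Delta_k^2}\Big\};$$ (c) for all $k\in\{1,\dots,K\}$,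 either $\tau^*_k\in\{\widehat\tau\}$ or $\tau^*_k$ is not a $(1.1\sqrt L+0.9,\,q,\,\widehat\tau^{(k)})$-high-energy change-point. -/

import Mathlib

open MeasureTheory ProbabilityTheory

noncomputable section

namespace ChangePoint

/-- The coordinate `v_i` of a vector of `ℝⁿ`, with coordinates numbered `1, …, n`. -/
def coord {n : ℕ} (v : EuclideanSpace ℝ (Fin n)) (i : ℕ) : ℝ :=
  if h : 1 ≤ i ∧ i ≤ n then v ⟨i - 1, by omega⟩ else 0

/-- A change-point vector `2 ≤ τ_1 < ⋯ < τ_m ≤ n` is encoded by the finite set `T` of its entries.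
`IsCPVector n T` says that all the entries are admissible positions. -/
def IsCPVector (n : ℕ) (T : Finset ℕ) : Prop := T ⊆ Finset.Icc 2 n

/-- The entry that precedes the position `t` in the change-point vector `T`, with the convention
`τ_0 = 1`. It is used for `2 ≤ t`. -/
def prevPt (T : Finset ℕ) (t : ℕ) : ℕ := sSup {s : ℕ | s < t ∧ (s = 1 ∨ s ∈ T)}

/-- The entry that follows the position `t` in the change-point vector `T`, with the convention
`τ_{m+1} = n + 1`. It is used for `t ≤ n`. -/
def nextPt (n : ℕ) (T : Finset ℕ) (t : ℕ) : ℕ := sInf {s : ℕ | t < s ∧ (s ∈ T ∨ s = n + 1)}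

/-- The space of the vectors that are constant on each segment `{τ_i, …, τ_{i+1} - 1}` of the
change-point vector `T`: two positions lie in the same segment if and only if they have the same
entries of `T` on their left (the coordinate `i : Fin n` is at the position `i + 1`). -/
def piecewiseConst (n : ℕ) (T : Finset ℕ) : Submodule ℝ (EuclideanSpace ℝ (Fin n)) where
  carrier := {v | ∀ i j : Fin n,
    (∀ t ∈ T, t ≤ (i : ℕ) + 1 ↔ t ≤ (j : ℕ) + 1) → v i = v j}
  add_mem' := by
    intro a b ha hb i j h
    simp [ha i j h, hb i j h]
  zero_mem' := by
    intro i j _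
    simp
  smul_mem' := by
    intro c a ha i j h
    simp [ha i j h]

/-- The multiscale penalty `q |τ| + 2 ∑_{i=1}^{|τ|+1} log (n / (τ_i - τ_{i-1}))`. -/
def pen (n : ℕ) (q : ℝ) (T : Finset ℕ) : ℝ :=
  q * (T.card : ℝ)
    + 2 * ∑ t ∈ insert (n + 1) T, Real.log ((n : ℝ) / ((t : ℝ) - (prevPt T t : ℝ)))

/-- The penalized least-squares criterion `‖Y - Π_τ Y‖² + L pen(τ, q)`. -/
def crit {n : ℕ} (L q : ℝ) (Y : EuclideanSpace ℝ (Fin n)) (T : Finset ℕ) : ℝ :=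
  ‖Y - (piecewiseConst n T).starProjection Y‖ ^ 2 + L * pen n q T

/-- `T` is a penalized least-squares estimator: any minimizer of the criterion over all the
change-point vectors. -/
def IsPLSE {n : ℕ} (L q : ℝ) (Y : EuclideanSpace ℝ (Fin n)) (T : Finset ℕ) : Prop :=
  IsCPVector n T ∧ ∀ S : Finset ℕ, IsCPVector n S → crit L q Y T ≤ crit L q Y S

/-- The change-point vector `τ*` of `θ`. -/
def trueCP {n : ℕ} (θ : EuclideanSpace ℝ (Fin n)) : Finset ℕ :=
  (Finset.Icc 2 n).filter (fun t => coord θ (t - 1) ≠ coord θ t)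

/-- The height `Δ_k = μ_{k+1} - μ_k` of the change-point of `θ` at the position `t = τ*_k`. -/
def height {n : ℕ} (θ : EuclideanSpace ℝ (Fin n)) (t : ℕ) : ℝ := coord θ t - coord θ (t - 1)

/-- The mean of `θ` on `[a, b)`. -/
def segMean {n : ℕ} (θ : EuclideanSpace ℝ (Fin n)) (a b : ℕ) : ℝ :=
  (∑ i ∈ Finset.Ico a b, coord θ i) / ((b : ℝ) - (a : ℝ))

/-- The energy `E(θ, (t₁, t₂, t₃))`. -/
def energy {n : ℕ} (θ : EuclideanSpace ℝ (Fin n)) (t₁ t₂ t₃ : ℕ) : ℝ :=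
  |segMean θ t₂ t₃ - segMean θ t₁ t₂|
    * Real.sqrt ((((t₂ : ℝ) - t₁) * ((t₃ : ℝ) - t₂)) / ((t₃ : ℝ) - t₁))

/-- The threshold `√(2 log (n (t₃ - t₁) / ((t₃ - t₂) (t₂ - t₁))) + q)`. -/
def threshold (n : ℕ) (q : ℝ) (t₁ t₂ t₃ : ℕ) : ℝ :=
  Real.sqrt (2 * Real.log (((n : ℝ) * ((t₃ : ℝ) - t₁))
    / (((t₃ : ℝ) - t₂) * ((t₂ : ℝ) - t₁))) + q)

/-- The entry `t = τ_l` of the change-point vector `T` is a `(κ, q, T)`-high-energy change-point of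
`θ`; for `T = τ*` this is a `(κ, q)`-high-energy change-point. -/
def IsHighEnergy {n : ℕ} (θ : EuclideanSpace ℝ (Fin n)) (κ q : ℝ) (T : Finset ℕ) (t : ℕ) : Prop :=
  t ∈ T ∧ κ * threshold n q (prevPt T t) t (nextPt n T t)
    < energy θ (prevPt T t) t (nextPt n T t)

/-- The distance `d_{H,1}(τ, t) = min_i |τ_i - t|` of `t` to the closest entry of the change-point
vector `T`; it is infinite when `T` is empty. -/
def distH1 (T : Finset ℕ) (t : ℕ) : EReal :=
  T.inf (fun s => ((|(s : ℝ) - (t : ℝ)| : ℝ) : EReal))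

/-- The entries of a change-point vector that lie in a set of reals. -/
def entriesIn (T : Finset ℕ) (I : Set ℝ) : Set ℕ := {t : ℕ | t ∈ T ∧ (t : ℝ) ∈ I}

/-- The noise vector: independent, centred, sub-Gaussian random variables with
`E[exp (s ε_i)] ≤ exp (s² / 2)` for all real `s`. -/
structure IsNoise {Ω : Type*} [MeasurableSpace Ω] {n : ℕ} (ε : Fin n → Ω → ℝ) (P : Measure Ω) :
    Prop where
  measurable : ∀ i, Measurable (ε i)
  indep : iIndepFun ε P
  mean_zero : ∀ i, ∫ ω, ε i ω ∂P = 0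
  subgaussian : ∀ i, HasSubgaussianMGF (ε i) 1 P

/-- The observation `Y = θ + ε`. -/
def observation {Ω : Type*} {n : ℕ} (θ : EuclideanSpace ℝ (Fin n)) (ε : Fin n → Ω → ℝ) (ω : Ω) :
    EuclideanSpace ℝ (Fin n) :=
  θ + WithLp.toLp 2 (fun i => ε i ω)

/-- At most two estimated change-points in each `[τ*_k, τ*_{k+1})` and at most one near each end of
it, for `k = 0, …, K` (`s = τ*_k` runs over `τ*_0 = 1` and the true change-points). -/
def FewChangePoints {n : ℕ} (θ : EuclideanSpace ℝ (Fin n)) (η : ℝ) (T : Finset ℕ) : Prop :=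
  ∀ s ∈ insert 1 (trueCP θ), ∀ s' : ℕ, s' = nextPt n (trueCP θ) s →
    (entriesIn T (Set.Ico (s : ℝ) s')).ncard ≤ 2 ∧
    (entriesIn T (Set.Icc (s : ℝ) (s + η * ((s' : ℝ) - s)))).ncard ≤ 1 ∧
    (entriesIn T (Set.Icc ((s' : ℝ) - η * ((s' : ℝ) - s)) s')).ncard ≤ 1

/-- The property **Detec[κ, q, c]** of the estimate `T`: every `(κ, q)`-high-energy change-point is
detected and localized. -/
def Detec {n : ℕ} (θ : EuclideanSpace ℝ (Fin n)) (κ q c : ℝ) (T : Finset ℕ) : Prop :=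
  ∀ t ∈ trueCP θ, IsHighEnergy θ κ q (trueCP θ) t →
    distH1 T t ≤
      ((min (((nextPt n (trueCP θ) t : ℝ) - t) / 2)
        (min (((t : ℝ) - prevPt (trueCP θ) t) / 2)
          (c * ((Real.log (n * height θ t ^ 2) + q) / height θ t ^ 2))) : ℝ) : EReal)

/-- Every true change-point `t` either belongs to `T` or is not `(κ, q, T^{(k)})`-high-energy,
where `T^{(k)}` is `T` with the entry `t = τ*_k` inserted. -/
def UnselectedLowEnergy {n : ℕ} (θ : EuclideanSpace ℝ (Fin n)) (κ q : ℝ) (T : Finset ℕ) : Prop :=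
  ∀ t ∈ trueCP θ, t ∈ T ∨ ¬ IsHighEnergy θ κ q (insert t T) t

end ChangePoint

end

open ChangePoint

/-
On an event where the squared contrasts of the noise are uniformly below a multiple of their
thresholds, the three properties are deterministic. Inserting a change-point between its neighbours
lowers the residual by a squared contrast and raises the penalty by `L` times a squared threshold,
so minimality bounds the contrasts of `Y` from above at all unselected positions and from below at
all selected ones. Over stretches where the signal is constant or jumps only once, a violation of
(a), (b) or (c) produces a contrast that contradicts one of these bounds.

For the event, the squared contrasts are gains of splits of the partial sums of the noise. There are
too many triples for a union bound, so each triple is rounded to a multiscale grid whose mesh is a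
small fraction of the two segment lengths. At each pair of scales the grid has about `n / l`
triples, where `l` is the smaller length; the term `2 log (n / l)` of the threshold compensates this
number exactly, and the excess `ξ` in the factor `1 + ξ` makes the sum over the scales converge.
The rounding error is controlled by chaining over dyadic blocks.
-/

namespace ChangePoint

section Neighbours

variable {n : ℕ} {T : Finset ℕ} {s t : ℕ}

lemma IsCPVector.two_le (hT : IsCPVector n T) (ht : t ∈ T) : 2 ≤ t :=
  (Finset.mem_Icc.1 (hT ht)).1

lemma IsCPVector.le (hT : IsCPVector n T) (ht : t ∈ T) : t ≤ n :=
  (Finset.mem_Icc.1 (hT ht)).2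

lemma IsCPVector.insert (hT : IsCPVector n T) (h2 : 2 ≤ t) (hn : t ≤ n) :
    IsCPVector n (insert t T) :=
  Finset.insert_subset (Finset.mem_Icc.2 ⟨h2, hn⟩) hT

lemma IsCPVector.erase (hT : IsCPVector n T) (t : ℕ) : IsCPVector n (T.erase t) :=
  (Finset.erase_subset t T).trans hT

lemma prevPt_lt (T : Finset ℕ) (ht : 2 ≤ t) : prevPt T t < t :=
  (Nat.sSup_mem (s := {s | s < t ∧ (s = 1 ∨ s ∈ T)}) ⟨1, by omega, Or.inl rfl⟩
    ⟨t, fun _ hs => hs.1.le⟩).1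

lemma prevPt_eq_one_or_mem (T : Finset ℕ) (ht : 2 ≤ t) : prevPt T t = 1 ∨ prevPt T t ∈ T :=
  (Nat.sSup_mem (s := {s | s < t ∧ (s = 1 ∨ s ∈ T)}) ⟨1, by omega, Or.inl rfl⟩
    ⟨t, fun _ hs => hs.1.le⟩).2

lemma le_prevPt (hst : s < t) (hs : s = 1 ∨ s ∈ T) : s ≤ prevPt T t :=
  le_csSup (⟨t, fun _ hs => hs.1.le⟩ : BddAbove {s | s < t ∧ (s = 1 ∨ s ∈ T)}) ⟨hst, hs⟩

lemma lt_nextPt (T : Finset ℕ) (ht : t ≤ n) : t < nextPt n T t :=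
  (Nat.sInf_mem (s := {s | t < s ∧ (s ∈ T ∨ s = n + 1)}) ⟨n + 1, by omega, Or.inr rfl⟩).1

lemma nextPt_mem_or_eq (T : Finset ℕ) (ht : t ≤ n) :
    nextPt n T t ∈ T ∨ nextPt n T t = n + 1 :=
  (Nat.sInf_mem (s := {s | t < s ∧ (s ∈ T ∨ s = n + 1)}) ⟨n + 1, by omega, Or.inr rfl⟩).2

lemma nextPt_le (hst : t < s) (hs : s ∈ T ∨ s = n + 1) : nextPt n T t ≤ s :=
  Nat.sInf_le (s := {s | t < s ∧ (s ∈ T ∨ s = n + 1)}) ⟨hst, hs⟩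

lemma prevPt_eq {a : ℕ} (hat : a < t) (ha1 : 1 ≤ a) (ha : a = 1 ∨ a ∈ T)
    (h : ∀ s ∈ T, s < t → s ≤ a) : prevPt T t = a := by
  refine le_antisymm ?_ (le_prevPt hat ha)
  have ht : 2 ≤ t := by omega
  rcases prevPt_eq_one_or_mem T ht with h1 | hT
  · omega
  · exact h _ hT (prevPt_lt T ht)

lemma nextPt_eq {c : ℕ} (htc : t < c) (hcn : c ≤ n + 1) (hc : c ∈ T ∨ c = n + 1)
    (h : ∀ s ∈ T, t < s → c ≤ s) : nextPt n T t = c := by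
  refine le_antisymm (nextPt_le htc hc) ?_
  have ht : t ≤ n := by omega
  rcases nextPt_mem_or_eq T ht with hT | h1
  · exact h _ hT (lt_nextPt T ht)
  · omega

lemma notMem_of_lt_nextPt (hts : t < s) (hs : s < nextPt n T t) : s ∉ T :=
  fun h => (nextPt_le hts (Or.inl h)).not_gt hs

lemma notMem_of_prevPt_lt (hs : prevPt T t < s) (hst : s < t) : s ∉ T :=
  fun h => (le_prevPt hst (Or.inr h)).not_gt hs

lemma prevPt_eq_of_lt_nextPt (h1 : 1 ≤ t) (ht : t ∈ T) (hts : t < s) (hs : s < nextPt n T t) :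
    prevPt T s = t :=
  prevPt_eq hts h1 (Or.inr ht) fun _ hu hus =>
    le_of_not_gt fun htu => notMem_of_lt_nextPt htu (hus.trans hs) hu

lemma nextPt_eq_of_lt_nextPt (hn : t ≤ n) (hts : t < s) (hs : s < nextPt n T t) :
    nextPt n T s = nextPt n T t :=
  nextPt_eq hs (nextPt_le (by omega) (Or.inr rfl)) (nextPt_mem_or_eq T hn) fun _ hu hsu =>
    nextPt_le (hts.trans hsu) (Or.inl hu)

lemma prevPt_eq_of_prevPt_lt (h2 : 2 ≤ t) (hs : prevPt T t < s) (hst : s < t) :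
    prevPt T s = prevPt T t :=
  prevPt_eq hs (le_prevPt (by omega) (Or.inl rfl)) (prevPt_eq_one_or_mem T h2) fun _ hu hus =>
    le_prevPt (hus.trans hst) (Or.inr hu)

lemma nextPt_eq_of_prevPt_lt (hn : t ≤ n) (ht : t ∈ T) (hs : prevPt T t < s) (hst : s < t) :
    nextPt n T s = t :=
  nextPt_eq hst (by omega) (Or.inl ht) fun _ hu hsu =>
    le_of_not_gt fun hut => notMem_of_prevPt_lt (hs.trans hsu) hut hu

lemma nextPt_eq_of_prevPt_lt_of_notMem (hn : t ≤ n) (ht : t ∉ T) (hs : prevPt T t < s)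
    (hst : s < t) : nextPt n T s = nextPt n T t := by
  refine nextPt_eq (hst.trans (lt_nextPt T hn)) (nextPt_le (by omega) (Or.inr rfl))
    (nextPt_mem_or_eq T hn) fun u hu hsu => ?_
  rcases lt_trichotomy u t with hut | rfl | htu
  · exact absurd hu (notMem_of_prevPt_lt (hs.trans hsu) hut)
  · exact absurd hu ht
  · exact nextPt_le htu (Or.inl hu)

lemma prevPt_eq_of_lt_nextPt_of_notMem (h2 : 2 ≤ t) (ht : t ∉ T) (hts : t < s)
    (hs : s < nextPt n T t) : prevPt T s = prevPt T t := by
  refine prevPt_eq ((prevPt_lt T h2).trans hts) (le_prevPt (by omega) (Or.inl rfl))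
    (prevPt_eq_one_or_mem T h2) fun u hu hus => ?_
  rcases lt_trichotomy u t with hut | rfl | htu
  · exact le_prevPt hut (Or.inr hu)
  · exact absurd hu ht
  · exact absurd hu (notMem_of_lt_nextPt htu (hus.trans hs))

lemma prevPt_insert_of_prevPt_lt (hs : prevPt T t < s) (hst : s < t) :
    prevPt (insert s T) t = s := by
  have h1 : 1 ≤ prevPt T t := le_prevPt (by omega) (Or.inl rfl)
  refine prevPt_eq hst (by omega) (Or.inr (Finset.mem_insert_self s T)) fun u hu hut => ?_
  rcases Finset.mem_insert.1 hu with rfl | hu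
  · exact le_rfl
  · exact (le_prevPt hut (Or.inr hu)).trans hs.le

lemma nextPt_insert_of_lt_nextPt (hsn : s ≤ n + 1) (hts : t < s) (hs : s < nextPt n T t) :
    nextPt n (insert s T) t = s := by
  refine nextPt_eq hts hsn (Or.inl (Finset.mem_insert_self s T)) fun u hu htu => ?_
  rcases Finset.mem_insert.1 hu with rfl | hu
  · exact le_rfl
  · exact hs.le.trans (nextPt_le htu (Or.inl hu))

lemma prevPt_insert_of_le (T : Finset ℕ) (hts : t ≤ s) : prevPt (insert s T) t = prevPt T t := by
  refine congrArg sSup (Set.ext fun u => and_congr_right fun hut => ?_)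
  rw [Finset.mem_insert, or_iff_right (hut.trans_le hts).ne]

lemma nextPt_insert_of_le (n : ℕ) (T : Finset ℕ) (hst : s ≤ t) :
    nextPt n (insert s T) t = nextPt n T t := by
  refine congrArg sInf (Set.ext fun u => and_congr_right fun htu => ?_)
  rw [Finset.mem_insert, or_iff_right (hst.trans_lt htu).ne']

lemma prevPt_insert_self (T : Finset ℕ) (t : ℕ) : prevPt (insert t T) t = prevPt T t :=
  prevPt_insert_of_le T le_rfl

lemma nextPt_insert_self (n : ℕ) (T : Finset ℕ) (t : ℕ) :
    nextPt n (insert t T) t = nextPt n T t :=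
  nextPt_insert_of_le n T le_rfl

/-- Two adjacent nonempty segments `[a, b)` and `[b, c)` of `{1, …, n}`, given by their end
points. -/
structure IsTriad (n a b c : ℕ) : Prop where
  one_le : 1 ≤ a
  left_lt : a < b
  lt_right : b < c
  le_succ : c ≤ n + 1

lemma isTriad_prevPt_nextPt (T : Finset ℕ) (h2 : 2 ≤ t) (hn : t ≤ n) :
    IsTriad n (prevPt T t) t (nextPt n T t) :=
  ⟨le_prevPt (by omega) (Or.inl rfl), prevPt_lt T h2, lt_nextPt T hn,
    nextPt_le (by omega) (Or.inr rfl)⟩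

lemma prevPt_insert_nextPt (T : Finset ℕ) (h2 : 2 ≤ t) (hn : t ≤ n) :
    prevPt (insert t T) (nextPt n T t) = t := by
  refine prevPt_eq (lt_nextPt T hn) (by omega) (Or.inr (Finset.mem_insert_self _ _)) ?_
  intro s hs hlt
  by_contra! hts
  have hsT : s ∈ T := Finset.mem_of_mem_insert_of_ne hs hts.ne'
  exact (nextPt_le hts (Or.inl hsT)).not_gt hlt

lemma prevPt_nextPt (h2 : 2 ≤ t) (hn : t ≤ n) (ht : t ∉ T) :
    prevPt T (nextPt n T t) = prevPt T t := by
  obtain ⟨h1, hat, htc, -⟩ := isTriad_prevPt_nextPt T h2 hn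
  refine prevPt_eq (hat.trans htc) h1 (prevPt_eq_one_or_mem T h2) fun s hs hlt => ?_
  refine le_prevPt (lt_of_not_ge fun hts => ?_) (Or.inr hs)
  have hts' : t < s := hts.lt_of_ne fun h => ht (h ▸ hs)
  exact (nextPt_le hts' (Or.inl hs)).not_gt hlt

lemma prevPt_insert_of_ne_nextPt (hT : IsCPVector n T) (h2 : 2 ≤ t) (hn : t ≤ n)
    (hs : s ∈ insert (n + 1) T) (hst : s ≠ t) (hsc : s ≠ nextPt n T t) :
    prevPt (insert t T) s = prevPt T s := by
  have hs' : s ∈ T ∨ s = n + 1 := (Finset.mem_insert.1 hs).symm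
  have hs2 : 2 ≤ s := hs'.elim hT.two_le fun h => by omega
  refine prevPt_eq (prevPt_lt T hs2) (le_prevPt (by omega) (Or.inl rfl))
    ((prevPt_eq_one_or_mem T hs2).imp_right Finset.mem_insert_of_mem) fun u hu hus => ?_
  rcases Finset.mem_insert.1 hu with rfl | hu
  · have hcs : nextPt n T u < s := (nextPt_le hus hs').lt_of_ne hsc.symm
    have hsn : s ≤ n + 1 := hs'.elim (fun h => (hT.le h).trans n.le_succ) le_of_eq
    have hcT : nextPt n T u ∈ T := (nextPt_mem_or_eq T hn).resolve_right (by omega)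
    exact (lt_nextPt T hn).le.trans (le_prevPt hcs (Or.inr hcT))
  · exact le_prevPt hus (Or.inr hu)

lemma sum_prevPt_insert {M : Type*} [AddCommGroup M] (f : ℕ → ℕ → M) (hT : IsCPVector n T)
    (h2 : 2 ≤ t) (hn : t ≤ n) (ht : t ∉ T) :
    ∑ s ∈ insert (n + 1) (insert t T), f (prevPt (insert t T) s) s
      = ∑ s ∈ insert (n + 1) T, f (prevPt T s) s - f (prevPt T t) (nextPt n T t)
        + (f (prevPt T t) t + f t (nextPt n T t)) := by
  have hc : nextPt n T t ∈ insert (n + 1) T :=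
    Finset.mem_insert.2 (nextPt_mem_or_eq T hn).symm
  have htT : t ∉ insert (n + 1) T := by
    rw [Finset.mem_insert, not_or]
    exact ⟨by omega, ht⟩
  have hrest : ∑ s ∈ (insert (n + 1) T).erase (nextPt n T t), f (prevPt (insert t T) s) s
      = ∑ s ∈ (insert (n + 1) T).erase (nextPt n T t), f (prevPt T s) s := by
    refine Finset.sum_congr rfl fun s hs => ?_
    obtain ⟨hsc, hs⟩ := Finset.mem_erase.1 hs
    rw [prevPt_insert_of_ne_nextPt hT h2 hn hs (fun h => htT (h ▸ hs)) hsc]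
  rw [Finset.insert_comm, Finset.sum_insert htT, prevPt_insert_self,
    ← Finset.add_sum_erase _ _ hc, prevPt_insert_nextPt T h2 hn, hrest,
    ← Finset.add_sum_erase (insert (n + 1) T) _ hc, prevPt_nextPt h2 hn ht]
  abel

end Neighbours

section IsTriad

variable {n a b c : ℕ}

lemma IsTriad.left_pos (h : IsTriad n a b c) : (0 : ℝ) < (b : ℝ) - a :=
  sub_pos.2 (Nat.cast_lt.2 h.left_lt)

lemma IsTriad.right_pos (h : IsTriad n a b c) : (0 : ℝ) < (c : ℝ) - b :=
  sub_pos.2 (Nat.cast_lt.2 h.lt_right)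

lemma IsTriad.pos (h : IsTriad n a b c) : (0 : ℝ) < (c : ℝ) - a :=
  sub_pos.2 (Nat.cast_lt.2 (h.left_lt.trans h.lt_right))

lemma IsTriad.length_le (h : IsTriad n a b c) : (c : ℝ) - a ≤ n := by
  have ha : (1 : ℝ) ≤ a := Nat.one_le_cast.2 h.one_le
  have hc : (c : ℝ) ≤ n + 1 := by exact_mod_cast h.le_succ
  linarith

lemma IsTriad.natCast_pos (h : IsTriad n a b c) : (0 : ℝ) < n := h.pos.trans_le h.length_le

/-- The square of `threshold`, defined as the quantity under its square root. -/
noncomputable def sqThreshold (n : ℕ) (q : ℝ) (a b c : ℕ) : ℝ :=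
  2 * Real.log (((n : ℝ) * ((c : ℝ) - a)) / (((c : ℝ) - b) * ((b : ℝ) - a))) + q

lemma IsTriad.le_sqThreshold (h : IsTriad n a b c) (q : ℝ) : q ≤ sqThreshold n q a b c := by
  have hab := h.left_pos
  have hbc := h.right_pos
  have hlog : 0 ≤ Real.log (((n : ℝ) * ((c : ℝ) - a)) / (((c : ℝ) - b) * ((b : ℝ) - a))) := by
    refine Real.log_nonneg ((one_le_div (mul_pos hbc hab)).2 ?_)
    have hn := h.length_le
    exact mul_le_mul (by linarith) (by linarith) hab.le (by linarith)
  unfold sqThreshold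
  linarith

lemma IsTriad.threshold_sq {q : ℝ} (h : IsTriad n a b c) (hq : 0 ≤ q) :
    threshold n q a b c ^ 2 = sqThreshold n q a b c :=
  Real.sq_sqrt (hq.trans (h.le_sqThreshold q))

lemma IsTriad.sqThreshold_eq (h : IsTriad n a b c) (q : ℝ) :
    sqThreshold n q a b c = q + 2 * (Real.log (n / ((b : ℝ) - a)) + Real.log (n / ((c : ℝ) - b))
      - Real.log (n / ((c : ℝ) - a))) := by
  have hn := h.natCast_pos.ne'
  have hab := h.left_pos.ne'
  have hbc := h.right_pos.ne'
  have hac := h.pos.ne'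
  rw [sqThreshold, Real.log_div (mul_ne_zero hn hac) (mul_ne_zero hbc hab), Real.log_mul hn hac,
    Real.log_mul hbc hab, Real.log_div hn hab, Real.log_div hn hbc, Real.log_div hn hac]
  ring

lemma pen_insert (q : ℝ) {T : Finset ℕ} {t : ℕ} (hT : IsCPVector n T) (h2 : 2 ≤ t)
    (hn : t ≤ n) (ht : t ∉ T) :
    pen n q (insert t T) = pen n q T + sqThreshold n q (prevPt T t) t (nextPt n T t) := by
  rw [pen, pen, (isTriad_prevPt_nextPt T h2 hn).sqThreshold_eq,
    sum_prevPt_insert (fun a b => Real.log ((n : ℝ) / ((b : ℝ) - a))) hT h2 hn ht,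
    Finset.card_insert_of_notMem ht]
  push_cast
  ring

end IsTriad

section Contrast

variable {n : ℕ} {T : Finset ℕ} {t a b c : ℕ}

lemma coord_val_succ (v : EuclideanSpace ℝ (Fin n)) (i : Fin n) : coord v (i + 1) = v i := by
  simp [coord]

lemma coord_add (v w : EuclideanSpace ℝ (Fin n)) (i : ℕ) :
    coord (v + w) i = coord v i + coord w i := by
  unfold coord
  split_ifs <;> simp

lemma coord_sub_smul (v w : EuclideanSpace ℝ (Fin n)) (r : ℝ) (i : ℕ) :
    coord (v - r • w) i = coord v i - r * coord w i := by
  unfold coord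
  split_ifs <;> simp

lemma segMean_eq_of_forall (v : EuclideanSpace ℝ (Fin n)) {x : ℝ} (hab : a < b)
    (h : ∀ k, a ≤ k → k < b → coord v k = x) : segMean v a b = x := by
  have hpos : (0 : ℝ) < (b : ℝ) - a := sub_pos.2 (Nat.cast_lt.2 hab)
  rw [segMean, Finset.sum_congr rfl fun k hk => h k (Finset.mem_Ico.1 hk).1 (Finset.mem_Ico.1 hk).2,
    Finset.sum_const, Nat.card_Ico, nsmul_eq_mul, Nat.cast_sub hab.le,
    mul_div_cancel_left₀ _ hpos.ne']

/-- The signed version of the energy: the normalized difference of the means of `v` on `[b, c)` and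
on `[a, b)`. -/
noncomputable def contrast {n : ℕ} (v : EuclideanSpace ℝ (Fin n)) (a b c : ℕ) : ℝ :=
  (segMean v b c - segMean v a b)
    * Real.sqrt ((((b : ℝ) - a) * ((c : ℝ) - b)) / ((c : ℝ) - a))

lemma energy_eq_abs_contrast (v : EuclideanSpace ℝ (Fin n)) (a b c : ℕ) :
    energy v a b c = |contrast v a b c| := by
  rw [contrast, abs_mul, abs_of_nonneg (Real.sqrt_nonneg _), energy]

lemma contrast_add (v w : EuclideanSpace ℝ (Fin n)) (a b c : ℕ) :
    contrast (v + w) a b c = contrast v a b c + contrast w a b c := by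
  simp only [contrast, segMean, coord_add, Finset.sum_add_distrib, add_div]
  ring

lemma IsTriad.contrast_sq (h : IsTriad n a b c) (v : EuclideanSpace ℝ (Fin n)) :
    contrast v a b c ^ 2 = (segMean v b c - segMean v a b) ^ 2
      * ((((b : ℝ) - a) * ((c : ℝ) - b)) / ((c : ℝ) - a)) := by
  rw [contrast, mul_pow, Real.sq_sqrt (div_nonneg (mul_pos h.left_pos h.right_pos).le h.pos.le)]

lemma isCPVector_trueCP (v : EuclideanSpace ℝ (Fin n)) : IsCPVector n (trueCP v) :=
  Finset.filter_subset _ _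

lemma coord_pred_eq (v : EuclideanSpace ℝ (Fin n)) (h2 : 2 ≤ t) (hn : t ≤ n)
    (ht : t ∉ trueCP v) : coord v (t - 1) = coord v t := by
  by_contra hne
  exact ht (Finset.mem_filter.2 ⟨Finset.mem_Icc.2 ⟨h2, hn⟩, hne⟩)

lemma coord_eq_of_forall_notMem_trueCP {v : EuclideanSpace ℝ (Fin n)} (ha : 1 ≤ a)
    (hc : c ≤ n + 1) (h : ∀ j, a < j → j < c → j ∉ trueCP v) {k : ℕ} (hak : a ≤ k) (hkc : k < c) :
    coord v k = coord v a := by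
  induction k, hak using Nat.le_induction with
  | base => rfl
  | succ k hak ih =>
    rw [← ih (by omega), ← coord_pred_eq v (by omega) (by omega) (h (k + 1) (by omega) hkc),
      Nat.add_sub_cancel]

lemma IsTriad.contrast_eq_zero (h : IsTriad n a b c) {v : EuclideanSpace ℝ (Fin n)}
    (hv : ∀ j, a < j → j < c → j ∉ trueCP v) : contrast v a b c = 0 := by
  have hconst {k : ℕ} : a ≤ k → k < c → coord v k = coord v a :=
    coord_eq_of_forall_notMem_trueCP h.one_le h.le_succ hv
  rw [contrast, segMean_eq_of_forall v h.left_lt fun k h1 h2 => hconst h1 (h2.trans h.lt_right),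
    segMean_eq_of_forall v h.lt_right fun k h1 h2 => hconst (h.left_lt.le.trans h1) h2, sub_self,
    zero_mul]

lemma mem_piecewiseConst_iff_trueCP_subset {v : EuclideanSpace ℝ (Fin n)} :
    v ∈ piecewiseConst n T ↔ trueCP v ⊆ T := by
  constructor
  · intro hv t ht
    obtain ⟨hmem, hne⟩ := Finset.mem_filter.1 ht
    obtain ⟨h2, hn⟩ := Finset.mem_Icc.1 hmem
    by_contra htT
    refine hne ?_
    rw [coord, dif_pos (by omega), coord, dif_pos (by omega)]
    refine hv _ _ fun s hs => ?_
    have hst : s ≠ t := fun h => htT (h ▸ hs)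
    dsimp only
    omega
  · intro hv i j hij
    wlog hle : i ≤ j generalizing i j
    · exact (this j i (fun s hs => (hij s hs).symm) (le_of_not_ge hle)).symm
    rw [← coord_val_succ v i, ← coord_val_succ v j]
    refine (coord_eq_of_forall_notMem_trueCP (c := j + 2) (by omega) (by omega) ?_ (by omega)
      (by omega)).symm
    intro s his hsj hs
    exact his.not_ge ((hij s (hv hs)).2 (by omega))

end Contrast

section SupSpanSingleton

variable {𝕜 E : Type*} [RCLike 𝕜] [NormedAddCommGroup E] [InnerProductSpace 𝕜 E]
  {K : Submodule 𝕜 E} {v : E} [K.HasOrthogonalProjection]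
  [(K ⊔ Submodule.span 𝕜 {v}).HasOrthogonalProjection]

lemma starProjection_sup_span_singleton (hv : ‖v‖ = 1) (hvK : v ∈ Kᗮ) (y : E) :
    (K ⊔ Submodule.span 𝕜 {v}).starProjection y = K.starProjection y + inner 𝕜 v y • v := by
  have hvP : inner 𝕜 v (K.starProjection y) = 0 :=
    Submodule.inner_left_of_mem_orthogonal (K.starProjection_apply_mem y) hvK
  apply Submodule.eq_starProjection_of_mem_orthogonal
  · exact Submodule.add_mem_sup (K.starProjection_apply_mem y)
      (Submodule.smul_mem _ _ (Submodule.mem_span_singleton_self v))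
  · rw [← sub_sub, ← Submodule.inf_orthogonal]
    refine ⟨Submodule.sub_mem _ (K.sub_starProjection_mem_orthogonal y)
      (Submodule.smul_mem _ _ hvK), Submodule.mem_orthogonal_singleton_iff_inner_right.2 ?_⟩
    simp [inner_sub_right, inner_smul_right, hvP, inner_self_eq_norm_sq_to_K, hv]

lemma norm_sub_starProjection_sup_span_singleton_sq (hv : ‖v‖ = 1) (hvK : v ∈ Kᗮ) (y : E) :
    ‖y - (K ⊔ Submodule.span 𝕜 {v}).starProjection y‖ ^ 2
      = ‖y - K.starProjection y‖ ^ 2 - ‖inner 𝕜 v y‖ ^ 2 := by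
  set K' := K ⊔ Submodule.span 𝕜 {v}
  have hvK' : inner 𝕜 v y • v ∈ K' :=
    Submodule.smul_mem _ _ (Submodule.mem_sup_right (Submodule.mem_span_singleton_self v))
  have hdecomp : y - K.starProjection y = (y - K'.starProjection y) + inner 𝕜 v y • v := by
    rw [starProjection_sup_span_singleton hv hvK]
    abel
  have horth : inner 𝕜 (y - K'.starProjection y) (inner 𝕜 v y • v) = 0 :=
    Submodule.inner_left_of_mem_orthogonal hvK' (K'.sub_starProjection_mem_orthogonal y)
  rw [eq_sub_iff_add_eq, hdecomp, sq, sq, sq,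
    norm_add_sq_eq_norm_sq_add_norm_sq_of_inner_eq_zero _ _ horth, norm_smul, hv, mul_one]

end SupSpanSingleton

section Split

variable {n : ℕ} {T : Finset ℕ} {t a b c : ℕ}

/-- The indicator vector of the segment `[a, b)`. -/
noncomputable def segInd (n a b : ℕ) : EuclideanSpace ℝ (Fin n) :=
  WithLp.toLp 2 fun i => if (i : ℕ) + 1 ∈ Finset.Ico a b then 1 else 0

lemma inner_segInd (v : EuclideanSpace ℝ (Fin n)) (ha : 1 ≤ a) (hb : b ≤ n + 1) :
    inner ℝ (segInd n a b) v = ∑ k ∈ Finset.Ico a b, coord v k := by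
  have hsub : Finset.Ico a b ⊆ Finset.Ico 1 (n + 1) := Finset.Ico_subset_Ico ha hb
  calc inner ℝ (segInd n a b) v
      = ∑ i : Fin n, if (i : ℕ) + 1 ∈ Finset.Ico a b then coord v (i + 1) else 0 := by
        simp [PiLp.inner_apply, segInd, coord_val_succ]
    _ = ∑ k ∈ Finset.Ico 1 (n + 1), if k ∈ Finset.Ico a b then coord v k else 0 := by
        rw [Fin.sum_univ_eq_sum_range fun k =>
          if k + 1 ∈ Finset.Ico a b then coord v (k + 1) else 0, Finset.sum_Ico_eq_sum_range]
        simp only [Nat.add_sub_cancel, add_comm 1]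
    _ = ∑ k ∈ Finset.Ico a b, coord v k := by
        rw [Finset.sum_ite_mem, Finset.inter_eq_right.2 hsub]

/-- The vector that is constant on `[a, b)` and on `[b, c)`, vanishes elsewhere, and represents
`fun v => contrast v a b c`. -/
noncomputable def splitVec (n a b c : ℕ) : EuclideanSpace ℝ (Fin n) :=
  Real.sqrt ((((b : ℝ) - a) * ((c : ℝ) - b)) / ((c : ℝ) - a)) •
    (((c : ℝ) - b)⁻¹ • segInd n b c - ((b : ℝ) - a)⁻¹ • segInd n a b)

lemma IsTriad.inner_splitVec (h : IsTriad n a b c) (v : EuclideanSpace ℝ (Fin n)) :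
    inner ℝ (splitVec n a b c) v = contrast v a b c := by
  have hb : 1 ≤ b := h.one_le.trans h.left_lt.le
  have hb' : b ≤ n + 1 := h.lt_right.le.trans h.le_succ
  simp only [splitVec, contrast, segMean, inner_smul_left, inner_sub_left,
    inner_segInd v hb h.le_succ, inner_segInd v h.one_le hb', conj_trivial]
  ring

lemma coord_splitVec {k : ℕ} (hk : 1 ≤ k) (hkn : k ≤ n) :
    coord (splitVec n a b c) k = Real.sqrt ((((b : ℝ) - a) * ((c : ℝ) - b)) / ((c : ℝ) - a)) *
      (((c : ℝ) - b)⁻¹ * (if k ∈ Finset.Ico b c then 1 else 0)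
        - ((b : ℝ) - a)⁻¹ * (if k ∈ Finset.Ico a b then 1 else 0)) := by
  rw [coord, dif_pos ⟨hk, hkn⟩]
  simp [splitVec, segInd, Nat.sub_add_cancel hk]

lemma IsTriad.coord_splitVec_left (h : IsTriad n a b c) {k : ℕ} (hak : a ≤ k) (hkb : k < b) :
    coord (splitVec n a b c) k
      = -(Real.sqrt ((((b : ℝ) - a) * ((c : ℝ) - b)) / ((c : ℝ) - a)) / ((b : ℝ) - a)) := by
  have h1 := h.one_le
  have h2 := h.lt_right
  have h3 := h.le_succ
  rw [coord_splitVec (by omega) (by omega), if_neg (by simp; omega), if_pos (by simp; omega)]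
  ring

lemma IsTriad.coord_splitVec_right (h : IsTriad n a b c) {k : ℕ} (hbk : b ≤ k) (hkc : k < c) :
    coord (splitVec n a b c) k
      = Real.sqrt ((((b : ℝ) - a) * ((c : ℝ) - b)) / ((c : ℝ) - a)) / ((c : ℝ) - b) := by
  have h1 := h.one_le
  have h2 := h.left_lt
  have h3 := h.le_succ
  rw [coord_splitVec (by omega) (by omega), if_pos (by simp; omega), if_neg (by simp; omega)]
  ring

lemma IsTriad.norm_splitVec (h : IsTriad n a b c) : ‖splitVec n a b c‖ = 1 := by
  have hab := h.left_pos
  have hbc := h.right_pos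
  have hac := h.pos
  have hsq : Real.sqrt ((((b : ℝ) - a) * ((c : ℝ) - b)) / ((c : ℝ) - a)) ^ 2
      = (((b : ℝ) - a) * ((c : ℝ) - b)) / ((c : ℝ) - a) := Real.sq_sqrt (by positivity)
  have hinner : inner ℝ (splitVec n a b c) (splitVec n a b c) = 1 := by
    rw [h.inner_splitVec, contrast,
      segMean_eq_of_forall _ h.lt_right fun k => h.coord_splitVec_right,
      segMean_eq_of_forall _ h.left_lt fun k => h.coord_splitVec_left]
    set ρ := Real.sqrt ((((b : ℝ) - a) * ((c : ℝ) - b)) / ((c : ℝ) - a))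
    calc (ρ / (c - b) - -(ρ / (b - a))) * ρ = ρ ^ 2 * (1 / (c - b) + 1 / (b - a)) := by ring
      _ = 1 := by rw [hsq]; field_simp; ring
  rw [← sq_eq_sq₀ (norm_nonneg _) zero_le_one, ← real_inner_self_eq_norm_sq, hinner, one_pow]

lemma trueCP_splitVec_subset (n a b c : ℕ) : trueCP (splitVec n a b c) ⊆ {a, b, c} := by
  intro s hs
  obtain ⟨hmem, hne⟩ := Finset.mem_filter.1 hs
  obtain ⟨h2, hn⟩ := Finset.mem_Icc.1 hmem
  by_contra hnot
  simp only [Finset.mem_insert, Finset.mem_singleton, not_or] at hnot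
  have hseg {u v : ℕ} (hu : s ≠ u) (hv : s ≠ v) :
      s - 1 ∈ Finset.Ico u v ↔ s ∈ Finset.Ico u v := by
    simp only [Finset.mem_Ico]
    omega
  refine hne ?_
  rw [coord_splitVec (by omega) (by omega), coord_splitVec (by omega) hn,
    if_congr (hseg hnot.2.1 hnot.2.2) rfl rfl, if_congr (hseg hnot.1 hnot.2.1) rfl rfl]

lemma splitVec_mem_piecewiseConst_insert (T : Finset ℕ) (h2 : 2 ≤ t) (hn : t ≤ n) :
    splitVec n (prevPt T t) t (nextPt n T t) ∈ piecewiseConst n (insert t T) := by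
  refine mem_piecewiseConst_iff_trueCP_subset.2 fun s hs => ?_
  have hs2 := (isCPVector_trueCP _).two_le hs
  have hsn := (isCPVector_trueCP _).le hs
  have hs' := trueCP_splitVec_subset _ _ _ _ hs
  simp only [Finset.mem_insert, Finset.mem_singleton] at hs' ⊢
  rcases hs' with rfl | rfl | rfl
  · exact Or.inr ((prevPt_eq_one_or_mem T h2).resolve_left (by omega))
  · exact Or.inl rfl
  · exact Or.inr ((nextPt_mem_or_eq T hn).resolve_right (by omega))

lemma contrast_eq_zero_of_mem_piecewiseConst (h2 : 2 ≤ t) (hn : t ≤ n) (ht : t ∉ T)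
    {w : EuclideanSpace ℝ (Fin n)} (hw : w ∈ piecewiseConst n T) :
    contrast w (prevPt T t) t (nextPt n T t) = 0 := by
  refine (isTriad_prevPt_nextPt T h2 hn).contrast_eq_zero fun s hs hs' hsw => ?_
  have hsT : s ∈ T := mem_piecewiseConst_iff_trueCP_subset.1 hw hsw
  rcases lt_trichotomy s t with hst | rfl | hts
  · exact hs.not_ge (le_prevPt hst (Or.inr hsT))
  · exact ht hsT
  · exact hs'.not_ge (nextPt_le hts (Or.inl hsT))

lemma piecewiseConst_insert (h2 : 2 ≤ t) (hn : t ≤ n) :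
    piecewiseConst n (insert t T)
      = piecewiseConst n T ⊔ Submodule.span ℝ {splitVec n (prevPt T t) t (nextPt n T t)} := by
  have htri := isTriad_prevPt_nextPt T h2 hn
  have hv := splitVec_mem_piecewiseConst_insert T h2 hn
  set v := splitVec n (prevPt T t) t (nextPt n T t) with hvdef
  refine le_antisymm (fun w hw => ?_) (sup_le (fun w hw => ?_)
    ((Submodule.span_singleton_le_iff_mem _ _).2 hv))
  · have hjump : coord v t - coord v (t - 1) ≠ 0 := by
      have hab := htri.left_pos
      have hbc := htri.right_pos
      have hac := htri.pos
      have hta := htri.left_lt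
      rw [hvdef, htri.coord_splitVec_right le_rfl htri.lt_right,
        htri.coord_splitVec_left (by omega) (by omega), sub_neg_eq_add]
      positivity
    set μ := (coord w t - coord w (t - 1)) / (coord v t - coord v (t - 1)) with hμ
    have hsub : w - μ • v ∈ piecewiseConst n T := by
      refine mem_piecewiseConst_iff_trueCP_subset.2 fun s hs => ?_
      obtain ⟨hmem, hne⟩ := Finset.mem_filter.1 hs
      obtain ⟨hs2, hsn⟩ := Finset.mem_Icc.1 hmem
      by_contra hsT
      refine hne ?_
      rw [coord_sub_smul, coord_sub_smul]
      by_cases hst : s = t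
      · have := div_mul_cancel₀ (coord w t - coord w (t - 1)) hjump
        rw [← hμ] at this
        subst hst
        linarith
      · have hcoord {u : EuclideanSpace ℝ (Fin n)} (hu : u ∈ piecewiseConst n (insert t T)) :
            coord u (s - 1) = coord u s :=
          coord_pred_eq u hs2 hsn fun h => hsT (Finset.mem_of_mem_insert_of_ne
            (mem_piecewiseConst_iff_trueCP_subset.1 hu h) hst)
        rw [hcoord hw, hcoord hv]
    exact Submodule.mem_sup.2 ⟨_, hsub, μ • v, Submodule.smul_mem _ _
      (Submodule.mem_span_singleton_self v), sub_add_cancel _ _⟩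
  · exact mem_piecewiseConst_iff_trueCP_subset.2
      ((mem_piecewiseConst_iff_trueCP_subset.1 hw).trans (Finset.subset_insert t T))

lemma crit_insert (L q : ℝ) (Y : EuclideanSpace ℝ (Fin n)) (hT : IsCPVector n T) (h2 : 2 ≤ t)
    (hn : t ≤ n) (ht : t ∉ T) :
    crit L q Y (insert t T) = crit L q Y T - contrast Y (prevPt T t) t (nextPt n T t) ^ 2
      + L * sqThreshold n q (prevPt T t) t (nextPt n T t) := by
  have htri := isTriad_prevPt_nextPt T h2 hn
  have horth : splitVec n (prevPt T t) t (nextPt n T t) ∈ (piecewiseConst n T)ᗮ :=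
    (Submodule.mem_orthogonal' _ _).2 fun w hw => by
      rw [htri.inner_splitVec, contrast_eq_zero_of_mem_piecewiseConst h2 hn ht hw]
  simp only [crit]
  rw [pen_insert q hT h2 hn ht]
  simp only [piecewiseConst_insert h2 hn]
  rw [norm_sub_starProjection_sup_span_singleton_sq htri.norm_splitVec horth,
    htri.inner_splitVec, Real.norm_eq_abs, sq_abs]
  ring

variable {L q : ℝ} {Y : EuclideanSpace ℝ (Fin n)}

lemma IsPLSE.contrast_sq_le (h : IsPLSE L q Y T) (h2 : 2 ≤ t) (hn : t ≤ n) (ht : t ∉ T) :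
    contrast Y (prevPt T t) t (nextPt n T t) ^ 2
      ≤ L * sqThreshold n q (prevPt T t) t (nextPt n T t) := by
  have hmin := h.2 _ (h.1.insert h2 hn)
  rw [crit_insert L q Y h.1 h2 hn ht] at hmin
  linarith

lemma IsPLSE.le_contrast_sq (h : IsPLSE L q Y T) (ht : t ∈ T) :
    L * sqThreshold n q (prevPt T t) t (nextPt n T t)
      ≤ contrast Y (prevPt T t) t (nextPt n T t) ^ 2 := by
  have hmin := h.2 _ (h.1.erase t)
  have hcrit := crit_insert L q Y (h.1.erase t) (h.1.two_le ht) (h.1.le ht)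
    (Finset.notMem_erase t T)
  rw [← prevPt_insert_self (T.erase t), ← nextPt_insert_self n (T.erase t),
    Finset.insert_erase ht] at hcrit
  linarith

end Split

section ShortSegment

variable {B s σ q n h d e x y m₁ m₂ m₃ : ℝ}

/-- The squared threshold as a function of the real lengths `h` and `d` of the two segments. -/
noncomputable def lenThreshold (n q h d : ℝ) : ℝ := 2 * Real.log (n * (h + d) / (h * d)) + q

lemma lenThreshold_comm (n q h d : ℝ) : lenThreshold n q h d = lenThreshold n q d h := by
  rw [lenThreshold, lenThreshold, add_comm h, mul_comm h]

lemma lenThreshold_le_mul (hq : 1 ≤ q) (hh : 0 < h) (hd : 0 < d) (hn : h ≤ n) :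
    lenThreshold n q h d ≤ (q + 2 * Real.log (n / h)) * (1 + 2 * (h / d)) := by
  have hζ : 0 < h / d := div_pos hh hd
  have hlog : 0 ≤ Real.log (n / h) := Real.log_nonneg ((one_le_div hh).2 hn)
  have hfactor : n * (h + d) / (h * d) = n / h * (1 + h / d) := by field_simp; ring
  have hlog' : Real.log (1 + h / d) ≤ h / d :=
    (Real.log_le_sub_one_of_pos (by linarith)).trans_eq (add_sub_cancel_left 1 (h / d))
  rw [lenThreshold, hfactor, Real.log_mul (div_pos (by linarith) hh).ne' (by linarith)]
  nlinarith

lemma mul_lenThreshold_le (hq : 1 ≤ q) (hh : 0 < h) (hhd : h ≤ d) (hdn : d ≤ n) (he : 0 < e) :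
    e / (d + e) * lenThreshold n q d e ≤ 3 * (q + 2 * Real.log (n / h)) := by
  have hd : 0 < d := hh.trans_le hhd
  have hn : 0 < n := hd.trans_le hdn
  set w := e / (d + e) with hw
  have hw0 : 0 < w := by positivity
  have hw1 : w ≤ 1 := (div_le_one (by linarith)).2 (by linarith)
  have hfactor : n * (d + e) / (d * e) = n / d * w⁻¹ := by rw [hw]; field_simp
  have hlogd : 0 ≤ Real.log (n / d) := Real.log_nonneg ((one_le_div hd).2 hdn)
  have hlogh : Real.log (n / d) ≤ Real.log (n / h) := by gcongr
  have hwlog : w * Real.log w⁻¹ ≤ 1 := by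
    calc w * Real.log w⁻¹ ≤ w * (w⁻¹ - 1) := by
          gcongr
          exact Real.log_le_sub_one_of_pos (inv_pos.2 hw0)
      _ = 1 - w := by field_simp
      _ ≤ 1 := by linarith
  rw [lenThreshold, hfactor, Real.log_mul (by positivity) (by positivity)]
  nlinarith

lemma le_lenThreshold (hh : 0 < h) (hd : 0 < d) (hn : 0 < n) :
    q + 2 * Real.log (n / h) ≤ lenThreshold n q h d := by
  have hlog : Real.log (n / h) ≤ Real.log (n * (h + d) / (h * d)) := by
    refine Real.log_le_log (by positivity) ?_
    rw [div_le_div_iff₀ hh (by positivity)]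
    nlinarith [mul_pos (mul_pos hn hh) hh]
  rw [lenThreshold]
  linarith

lemma abs_mul_sqrt_le_of_sq_le (hB : 0 ≤ B) (hq : 1 ≤ q) (hh : 0 < h) (hd : 0 < d) (hn : h ≤ n)
    (hx : x ^ 2 * (h * d / (h + d)) ≤ B ^ 2 * lenThreshold n q h d) :
    |x * √h| ≤ B * (1 + 2 * (h / d)) * √(q + 2 * Real.log (n / h)) := by
  have hζ : 0 < h / d := div_pos hh hd
  have hlog : 0 ≤ Real.log (n / h) := Real.log_nonneg ((one_le_div hh).2 hn)
  refine abs_le_of_sq_le_sq ?_ (by positivity)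
  rw [mul_pow, mul_pow, Real.sq_sqrt hh.le, Real.sq_sqrt (by linarith)]
  set t := q + 2 * Real.log (n / h)
  calc x ^ 2 * h = x ^ 2 * (h * d / (h + d)) * (1 + h / d) := by field_simp; ring
    _ ≤ B ^ 2 * (t * (1 + 2 * (h / d))) * (1 + 2 * (h / d)) := by
        refine mul_le_mul (hx.trans ?_) (by linarith) (by linarith) (by positivity)
        exact mul_le_mul_of_nonneg_left (lenThreshold_le_mul hq hh hd hn) (sq_nonneg B)
    _ = (B * (1 + 2 * (h / d))) ^ 2 * t := by ring

lemma abs_div_mul_sqrt_le_of_sq_le (hs : 0 ≤ s) (hσ : 0 ≤ σ) (hq : 1 ≤ q) (hh : 0 < h)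
    (hhd : h ≤ d) (hhσ : h / d ≤ σ ^ 2) (hdn : d ≤ n) (he : 0 < e)
    (hy : y ^ 2 * (d * e / (d + e)) ≤ s ^ 2 * lenThreshold n q d e) :
    |e / (d + e) * y * √h| ≤ 2 * s * σ * √(q + 2 * Real.log (n / h)) := by
  have hd : 0 < d := hh.trans_le hhd
  have hlog : 0 ≤ Real.log (n / h) := Real.log_nonneg ((one_le_div hh).2 (hhd.trans hdn))
  have hthr := mul_lenThreshold_le hq hh hhd hdn he
  refine abs_le_of_sq_le_sq ?_ (by positivity)
  rw [mul_pow, mul_pow _ √_, Real.sq_sqrt hh.le, Real.sq_sqrt (by linarith)]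
  set t := q + 2 * Real.log (n / h)
  have ht : 0 ≤ t := by positivity
  calc (e / (d + e) * y) ^ 2 * h = y ^ 2 * (d * e / (d + e)) * (e / (d + e) * (h / d)) := by
        field_simp
    _ ≤ s ^ 2 * lenThreshold n q d e * (e / (d + e) * (h / d)) := by gcongr
    _ = s ^ 2 * (h / d) * (e / (d + e) * lenThreshold n q d e) := by ring
    _ ≤ s ^ 2 * (h / d) * (3 * t) := by gcongr
    _ ≤ s ^ 2 * σ ^ 2 * (3 * t) := by gcongr
    _ ≤ (2 * s * σ) ^ 2 * t := by nlinarith [mul_nonneg (sq_nonneg (s * σ)) ht]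

/-- The noise level at which the contrasts of the noise have to be controlled: it is the part of
the constant `1.1 √L + 0.9` that is left to the noise. -/
noncomputable def noiseRatio (L : ℝ) : ℝ := 0.1 * √L + 0.9

/-- The fraction `η_L` of a segment on which at most one change-point is estimated near each of its
ends. -/
noncomputable def endRatio (L : ℝ) : ℝ := ((√L - 1) / (5 * √L)) ^ 2 / 2

variable {L : ℝ}

lemma one_lt_sqrt (hL : 1 < L) : 1 < √L := Real.lt_sqrt_of_sq_lt (by simpa using hL)

lemma noiseRatio_nonneg (L : ℝ) : 0 ≤ noiseRatio L := by
  unfold noiseRatio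
  positivity

lemma noiseRatio_sq_lt (hL : 1 < L) : noiseRatio L ^ 2 < L := by
  have hs := one_lt_sqrt hL
  rw [← Real.lt_sqrt (noiseRatio_nonneg L), noiseRatio]
  linarith

lemma endRatio_pos (hL : 1 < L) : 0 < endRatio L := by
  have hs : 0 < √L - 1 := sub_pos.2 (one_lt_sqrt hL)
  unfold endRatio
  positivity

lemma two_mul_endRatio (L : ℝ) : 2 * endRatio L = ((√L - 1) / (5 * √L)) ^ 2 := by
  rw [endRatio, mul_div_cancel₀ _ two_ne_zero]

lemma endRatio_le (hL : 1 < L) : endRatio L ≤ 1 / 2 := by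
  have hs := one_lt_sqrt hL
  have hσ : (√L - 1) / (5 * √L) ≤ 1 := (div_le_one (by linarith)).2 (by linarith)
  have hσ2 := pow_le_one₀ (n := 2) (div_nonneg (by linarith) (by linarith)) hσ
  linarith [two_mul_endRatio L]

/-- Compared with the contrast of the first segment with the second one, the contrast with the
union of the second and the third one changes little, as the mean of the union is determined by the
second segment up to an error that is small on the scale of the first segment. -/
lemma sq_mul_lt_of_short (hL : 1 < L) (hq : 1 ≤ q) (hh : 0 < h) (hd : 0 < d) (he : 0 < e)
    (hn : h + d + e ≤ n) (hhd : h ≤ 2 * endRatio L * d)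
    (hx : (m₂ - m₁) ^ 2 * (h * d / (h + d)) ≤ noiseRatio L ^ 2 * lenThreshold n q h d)
    (hy : (m₃ - m₂) ^ 2 * (d * e / (d + e)) ≤ L * lenThreshold n q d e) :
    ((d * m₂ + e * m₃) / (d + e) - m₁) ^ 2 * (h * (d + e) / (h + (d + e)))
      < L * lenThreshold n q h (d + e) := by
  have hs := one_lt_sqrt hL
  have hsL : √L ^ 2 = L := Real.sq_sqrt (by linarith)
  set σ := (√L - 1) / (5 * √L) with hσ
  have hσ0 : 0 ≤ σ := div_nonneg (by linarith) (by linarith)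
  have hσs : √L * σ = (√L - 1) / 5 := by rw [hσ]; field_simp
  have hhσ : h / d ≤ σ ^ 2 := (div_le_iff₀ hd).2 (hhd.trans_eq (by rw [two_mul_endRatio]))
  have hhd' : h ≤ d := by nlinarith [endRatio_le hL]
  have hlog : 0 ≤ Real.log (n / h) := Real.log_nonneg ((one_le_div hh).2 (by linarith))
  have hx' := abs_mul_sqrt_le_of_sq_le (noiseRatio_nonneg L) hq hh hd (by linarith) hx
  have hy' := abs_div_mul_sqrt_le_of_sq_le (n := n) (Real.sqrt_nonneg L) hσ0 hq hh hhd' hhσ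
    (by linarith) he (hy.trans_eq (by rw [hsL]))
  set t := q + 2 * Real.log (n / h)
  have hsum : |(m₂ - m₁) * √h + e / (d + e) * (m₃ - m₂) * √h| < √L * √t := by
    refine (abs_add_le _ _).trans_lt ((add_le_add hx' hy').trans_lt ?_)
    rw [← add_mul]
    refine mul_lt_mul_of_pos_right ?_ (Real.sqrt_pos.2 (by positivity))
    unfold noiseRatio
    nlinarith
  calc ((d * m₂ + e * m₃) / (d + e) - m₁) ^ 2 * (h * (d + e) / (h + (d + e)))
      ≤ ((d * m₂ + e * m₃) / (d + e) - m₁) ^ 2 * h := by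
        gcongr
        exact (div_le_iff₀ (by positivity)).2 (by nlinarith)
    _ = |(m₂ - m₁) * √h + e / (d + e) * (m₃ - m₂) * √h| ^ 2 := by
        rw [sq_abs, ← add_mul, mul_pow _ √h, Real.sq_sqrt hh.le]
        field_simp
        ring
    _ < (√L * √t) ^ 2 := pow_lt_pow_left₀ hsum (abs_nonneg _) two_ne_zero
    _ = L * t := by rw [mul_pow, hsL, Real.sq_sqrt (by positivity)]
    _ ≤ L * lenThreshold n q h (d + e) := by
        gcongr
        exact le_lenThreshold hh (by positivity) (by linarith)

variable {N a b c k : ℕ}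

lemma sqThreshold_eq_lenThreshold (N : ℕ) (q : ℝ) (a b c : ℕ) :
    sqThreshold N q a b c = lenThreshold N q ((b : ℝ) - a) ((c : ℝ) - b) := by
  rw [sqThreshold, lenThreshold, add_comm ((b : ℝ) - a), sub_add_sub_cancel, mul_comm ((b : ℝ) - a)]

lemma segMean_eq_add_div (v : EuclideanSpace ℝ (Fin N)) (hab : a < b) (hbc : b < c) :
    segMean v a c = (((b : ℝ) - a) * segMean v a b + ((c : ℝ) - b) * segMean v b c)
      / (((b : ℝ) - a) + ((c : ℝ) - b)) := by
  have hab' : (0 : ℝ) < (b : ℝ) - a := sub_pos.2 (Nat.cast_lt.2 hab)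
  have hbc' : (0 : ℝ) < (c : ℝ) - b := sub_pos.2 (Nat.cast_lt.2 hbc)
  rw [segMean, segMean, segMean, mul_div_cancel₀ _ hab'.ne', mul_div_cancel₀ _ hbc'.ne',
    Finset.sum_Ico_consecutive _ hab.le hbc.le]
  ring

lemma IsTriad.contrast_sq_lt_of_short_left {v : EuclideanSpace ℝ (Fin N)} (hL : 1 < L)
    (hq : 1 ≤ q) (h₁ : IsTriad N a b c) (h₂ : IsTriad N b c k)
    (hshort : (b : ℝ) - a ≤ 2 * endRatio L * ((c : ℝ) - b))
    (H₁ : contrast v a b c ^ 2 ≤ noiseRatio L ^ 2 * sqThreshold N q a b c)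
    (H₂ : contrast v b c k ^ 2 ≤ L * sqThreshold N q b c k) :
    contrast v a b k ^ 2 < L * sqThreshold N q a b k := by
  have h : IsTriad N a b k := ⟨h₁.one_le, h₁.left_lt, h₂.left_lt.trans h₂.lt_right, h₂.le_succ⟩
  rw [IsTriad.contrast_sq ‹_›, sqThreshold_eq_lenThreshold] at H₁ H₂ ⊢
  rw [segMean_eq_add_div v h₂.left_lt h₂.lt_right]
  have hsum : (k : ℝ) - b = ((c : ℝ) - b) + ((k : ℝ) - c) := by ring
  have key := sq_mul_lt_of_short hL hq h₁.left_pos h₂.left_pos h₂.right_pos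
    (n := N) (by linarith [h.length_le]) hshort (by simpa using H₁) (by simpa using H₂)
  rw [← hsum] at key ⊢
  simpa using key

lemma IsTriad.contrast_sq_lt_of_short_right {v : EuclideanSpace ℝ (Fin N)} (hL : 1 < L)
    (hq : 1 ≤ q) (h₁ : IsTriad N a b c) (h₂ : IsTriad N b c k)
    (hshort : (k : ℝ) - c ≤ 2 * endRatio L * ((c : ℝ) - b))
    (H₁ : contrast v a b c ^ 2 ≤ L * sqThreshold N q a b c)
    (H₂ : contrast v b c k ^ 2 ≤ noiseRatio L ^ 2 * sqThreshold N q b c k) :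
    contrast v a c k ^ 2 < L * sqThreshold N q a c k := by
  have h : IsTriad N a c k := ⟨h₁.one_le, h₁.left_lt.trans h₁.lt_right, h₂.lt_right, h₂.le_succ⟩
  rw [IsTriad.contrast_sq ‹_›, sqThreshold_eq_lenThreshold, lenThreshold_comm, sub_sq_comm,
    mul_comm ((_ : ℝ) - _) (_ - _)] at H₁ H₂ ⊢
  rw [segMean_eq_add_div v h₁.left_lt h₁.lt_right]
  have hsum : (c : ℝ) - a = ((c : ℝ) - b) + ((b : ℝ) - a) := by ring
  have key := sq_mul_lt_of_short hL hq h₂.right_pos h₂.left_pos h₁.left_pos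
    (n := N) (by linarith [h.length_le]) hshort (by simpa using H₂) (by simpa using H₁)
  rw [← hsum] at key
  rw [add_comm (((b : ℝ) - a) * _), add_comm ((b : ℝ) - a), ← hsum]
  simpa using key

end ShortSegment

section FewChangePoints

variable {n s s' t : ℕ} {L M q : ℝ} {θ e : EuclideanSpace ℝ (Fin n)} {T : Finset ℕ}

/-- All the contrasts of the noise vector `e` are within a factor `√M` of the threshold. -/
def ContrastsBounded (M q : ℝ) {n : ℕ} (e : EuclideanSpace ℝ (Fin n)) : Prop :=
  ∀ a b c : ℕ, IsTriad n a b c → contrast e a b c ^ 2 ≤ M * sqThreshold n q a b c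

lemma ContrastsBounded.mono {M' : ℝ} (he : ContrastsBounded M q e) (hM : M ≤ M') (hq : 0 ≤ q) :
    ContrastsBounded M' q e := fun a b c h =>
  (he a b c h).trans (mul_le_mul_of_nonneg_right hM (hq.trans (h.le_sqThreshold q)))

lemma ContrastsBounded.contrast_add_sq_le {a b c : ℕ} (he : ContrastsBounded M q e)
    (h : IsTriad n a b c) (hθ : ∀ j, a < j → j < c → j ∉ trueCP θ) :
    contrast (θ + e) a b c ^ 2 ≤ M * sqThreshold n q a b c := by
  rw [contrast_add, h.contrast_eq_zero hθ, zero_add]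
  exact he a b c h

lemma le_two_mul_endRatio_mul {h d D : ℝ} (hL : 1 < L) (hD : 0 ≤ D) (h₁ : h ≤ endRatio L * D)
    (h₂ : D - endRatio L * D ≤ d) : h ≤ 2 * endRatio L * d := by
  have hη := (endRatio_pos hL).le
  nlinarith [mul_nonneg hη (sub_nonneg.2 h₂),
    mul_nonneg (mul_nonneg hη hD) (sub_nonneg.2 (endRatio_le hL))]

lemma IsPLSE.prevPt_lt_or_lt_nextPt (h : IsPLSE L q (θ + e) T) (hM : M < L) (hq : 0 < q)
    (he : ContrastsBounded M q e) (hseg : ∀ j, s < j → j < s' → j ∉ trueCP θ) (ht : t ∈ T) :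
    prevPt T t < s ∨ s' < nextPt n T t := by
  by_contra! hcon
  have htri := isTriad_prevPt_nextPt T (h.1.two_le ht) (h.1.le ht)
  have hupper := he.contrast_add_sq_le htri fun j hj hj' =>
    hseg j (hcon.1.trans_lt hj) (hj'.trans_le hcon.2)
  have hlower := h.le_contrast_sq ht
  have hthr := htri.le_sqThreshold q
  nlinarith

lemma IsPLSE.add_endRatio_mul_lt (h : IsPLSE L q (θ + e) T) (hL : 1 < L) (hq : 1 ≤ q)
    (he : ContrastsBounded (noiseRatio L ^ 2) q e) (hseg : ∀ j, s < j → j < s' → j ∉ trueCP θ)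
    (ht : t ∈ T) (hs : s ≤ prevPt T t) (hs' : t < s') : s + endRatio L * ((s' : ℝ) - s) < t := by
  by_contra! hnear
  have htri := isTriad_prevPt_nextPt T (h.1.two_le ht) (h.1.le ht)
  have hnext : s' < nextPt n T t :=
    (h.prevPt_lt_or_lt_nextPt (noiseRatio_sq_lt hL) (by linarith) he hseg ht).resolve_left
      hs.not_gt
  have hend : s' ≤ n := Nat.lt_succ_iff.1 (hnext.trans_le htri.le_succ)
  have htri₁ : IsTriad n (prevPt T t) t s' :=
    ⟨htri.one_le, htri.left_lt, hs', hend.trans (Nat.le_succ n)⟩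
  have htri₂ : IsTriad n t s' (nextPt n T t) := ⟨by have := h.1.two_le ht; omega, hs', hnext,
    htri.le_succ⟩
  have H₁ := he.contrast_add_sq_le htri₁ fun j hj hj' => hseg j (hs.trans_lt hj) hj'
  have H₂ := h.contrast_sq_le (t := s') (by have := htri₂.one_le; omega) hend
    (notMem_of_lt_nextPt hs' hnext)
  rw [prevPt_eq_of_lt_nextPt htri₂.one_le ht hs' hnext,
    nextPt_eq_of_lt_nextPt (h.1.le ht) hs' hnext] at H₂
  refine (htri₁.contrast_sq_lt_of_short_left hL hq htri₂ ?_ H₁ H₂).not_ge (h.le_contrast_sq ht)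
  have hs_cast : (s : ℝ) ≤ prevPt T t := Nat.cast_le.2 hs
  have hlen := htri₁.pos
  exact le_two_mul_endRatio_mul (D := (s' : ℝ) - s) hL (by linarith) (by linarith) (by linarith)

lemma IsPLSE.lt_sub_endRatio_mul (h : IsPLSE L q (θ + e) T) (hL : 1 < L) (hq : 1 ≤ q)
    (he : ContrastsBounded (noiseRatio L ^ 2) q e) (hseg : ∀ j, s < j → j < s' → j ∉ trueCP θ)
    (ht : t ∈ T) (hs : s < t) (hs' : nextPt n T t ≤ s') : t < s' - endRatio L * ((s' : ℝ) - s) := by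
  by_contra! hnear
  have hn := h.1.le ht
  have h2 := h.1.two_le ht
  have htri := isTriad_prevPt_nextPt T h2 hn
  have hprev : prevPt T t < s :=
    (h.prevPt_lt_or_lt_nextPt (noiseRatio_sq_lt hL) (by linarith) he hseg ht).resolve_right
      hs'.not_gt
  have hs1 : 1 < s := htri.one_le.trans_lt hprev
  have htri₁ : IsTriad n (prevPt T t) s t := ⟨htri.one_le, hprev, hs, by omega⟩
  have htri₂ : IsTriad n s t (nextPt n T t) := ⟨hs1.le, hs, htri.lt_right, htri.le_succ⟩
  have H₁ := h.contrast_sq_le (t := s) hs1 (by omega) (notMem_of_prevPt_lt hprev hs)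
  rw [prevPt_eq_of_prevPt_lt h2 hprev hs, nextPt_eq_of_prevPt_lt hn ht hprev hs] at H₁
  have H₂ := he.contrast_add_sq_le htri₂ fun j hj hj' => hseg j hj (hj'.trans_le hs')
  refine (htri₁.contrast_sq_lt_of_short_right hL hq htri₂ ?_ H₁ H₂).not_ge (h.le_contrast_sq ht)
  have hs_cast : (nextPt n T t : ℝ) ≤ s' := Nat.cast_le.2 hs'
  have hlen := htri₂.pos
  exact le_two_mul_endRatio_mul (D := (s' : ℝ) - s) hL (by linarith) (by linarith) (by linarith)

lemma exists_orderEmb_mem_of_le_ncard {α : Type*} [LinearOrder α] {S : Set α} {k : ℕ}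
    (hS : S.Finite) (h : k ≤ S.ncard) : ∃ f : Fin k ↪o α, ∀ i, f i ∈ S := by
  rw [Set.ncard_eq_toFinset_card S hS] at h
  exact ⟨Finset.orderEmbOfCardLe _ h,
    fun i => hS.mem_toFinset.1 (Finset.orderEmbOfCardLe_mem _ h i)⟩

lemma finite_entriesIn (T : Finset ℕ) (I : Set ℝ) : (entriesIn T I).Finite :=
  T.finite_toSet.subset fun _ h => h.1

lemma ncard_entriesIn_le_one {I : Set ℝ}
    (h : ∀ x ∈ T, ∀ y ∈ T, x < y → (x : ℝ) ∈ I → (y : ℝ) ∉ I) : (entriesIn T I).ncard ≤ 1 := by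
  by_contra! hcard
  obtain ⟨f, hf⟩ := exists_orderEmb_mem_of_le_ncard (finite_entriesIn T I) hcard
  exact h _ (hf 0).1 _ (hf 1).1 (f.strictMono (by decide)) (hf 0).2 (hf 1).2

lemma IsPLSE.ncard_entriesIn_Ico_le (h : IsPLSE L q (θ + e) T) (hM : M < L) (hq : 0 < q)
    (he : ContrastsBounded M q e) (hseg : ∀ j, s < j → j < s' → j ∉ trueCP θ) :
    (entriesIn T (Set.Ico (s : ℝ) s')).ncard ≤ 2 := by
  by_contra! hcard
  obtain ⟨f, hf⟩ := exists_orderEmb_mem_of_le_ncard (finite_entriesIn T _) hcard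
  have hs : s ≤ f 0 := Nat.cast_le.1 (hf 0).2.1
  have hs' : f 2 < s' := Nat.cast_lt.1 (hf 2).2.2
  have hprev : f 0 ≤ prevPt T (f 1) := le_prevPt (f.strictMono (by decide)) (Or.inr (hf 0).1)
  have hnext : nextPt n T (f 1) ≤ f 2 := nextPt_le (f.strictMono (by decide)) (Or.inl (hf 2).1)
  have := h.prevPt_lt_or_lt_nextPt hM hq he hseg (hf 1).1
  omega

lemma IsPLSE.fewChangePoints (h : IsPLSE L q (θ + e) T) (hn : 1 ≤ n) (hL : 1 < L) (hq : 1 ≤ q)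
    (he : ContrastsBounded (noiseRatio L ^ 2) q e) : FewChangePoints θ (endRatio L) T := by
  rintro s hs _ rfl
  set s' := nextPt n (trueCP θ) s
  have hseg : ∀ j, s < j → j < s' → j ∉ trueCP θ := fun j => notMem_of_lt_nextPt
  have hsn : s ≤ n := (Finset.mem_insert.1 hs).elim (fun hs1 => hs1 ▸ hn) (isCPVector_trueCP θ).le
  have hlen : (0 : ℝ) < s' - s := sub_pos.2 (Nat.cast_lt.2 (lt_nextPt _ hsn))
  have hη : endRatio L * ((s' : ℝ) - s) < s' - s := by nlinarith [endRatio_le hL]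
  refine ⟨h.ncard_entriesIn_Ico_le (noiseRatio_sq_lt hL) (by linarith) he hseg,
    ncard_entriesIn_le_one fun x hx y hy hxy hxI hyI => ?_,
    ncard_entriesIn_le_one fun x hx y hy hxy hxI hyI => ?_⟩
  · have hsx : s ≤ x := Nat.cast_le.1 hxI.1
    have hys' : y < s' := Nat.cast_lt.1 (hyI.2.trans_lt (by linarith) : (y : ℝ) < s')
    exact (h.add_endRatio_mul_lt hL hq he hseg hy (hsx.trans (le_prevPt hxy (Or.inr hx)))
      hys').not_ge hyI.2
  · have hys' : y ≤ s' := Nat.cast_le.1 hyI.2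
    have hsx : s < x := Nat.cast_lt.1 (lt_of_lt_of_le (by linarith) hxI.1 : (s : ℝ) < x)
    exact (h.lt_sub_endRatio_mul hL hq he hseg hx hsx
      ((nextPt_le hxy (Or.inl hy)).trans hys')).not_ge hxI.1

end FewChangePoints

section UnselectedLowEnergy

variable {n a b c : ℕ} {B L q : ℝ} {θ e v : EuclideanSpace ℝ (Fin n)} {T : Finset ℕ}

lemma IsTriad.abs_contrast_le (h : IsTriad n a b c) (hB : 0 ≤ B) (hq : 0 ≤ q)
    (hv : contrast v a b c ^ 2 ≤ B ^ 2 * sqThreshold n q a b c) :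
    |contrast v a b c| ≤ B * threshold n q a b c :=
  abs_le_of_sq_le_sq (by rwa [mul_pow, h.threshold_sq hq]) (mul_nonneg hB (Real.sqrt_nonneg _))

lemma IsPLSE.unselectedLowEnergy (h : IsPLSE L q (θ + e) T) (hL : 0 ≤ L) (hq : 0 ≤ q)
    (he : ContrastsBounded (noiseRatio L ^ 2) q e) :
    UnselectedLowEnergy θ (1.1 * √L + 0.9) q T := by
  refine fun t ht => or_iff_not_imp_left.2 fun htT ⟨_, hE⟩ => ?_
  have h2 := (isCPVector_trueCP θ).two_le ht
  have hn := (isCPVector_trueCP θ).le ht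
  have htri := isTriad_prevPt_nextPt T h2 hn
  rw [prevPt_insert_self, nextPt_insert_self, energy_eq_abs_contrast] at hE
  have hnoise := htri.abs_contrast_le (noiseRatio_nonneg L) hq (he _ _ _ htri)
  have hobs := htri.abs_contrast_le (v := θ + e) (Real.sqrt_nonneg L) hq
    ((h.contrast_sq_le h2 hn htT).trans_eq (by rw [Real.sq_sqrt hL]))
  have htriangle := abs_sub (contrast (θ + e) (prevPt T t) t (nextPt n T t))
    (contrast e (prevPt T t) t (nextPt n T t))
  rw [contrast_add, add_sub_cancel_right, ← contrast_add] at htriangle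
  unfold noiseRatio at hnoise
  linarith

end UnselectedLowEnergy

section DetectionRadius

variable {κ L q n D u v : ℝ}

/-- The distance within which a change-point of squared height `D` is detected, when the segments on
its two sides have the lengths `u` and `v`. -/
noncomputable def detectionRadius (κ q n D u v : ℝ) : ℝ :=
  min (v / 2) (min (u / 2) (κ * ((Real.log (n * D) + q) / D)))

lemma le_lenThreshold_of_add_le (hu : 0 < u) (hv : 0 < v) (hn : u + v ≤ n) :
    q ≤ lenThreshold n q u v := by
  have hlog : 0 ≤ Real.log (n / u) := Real.log_nonneg ((one_le_div hu).2 (by linarith))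
  linarith [le_lenThreshold (q := q) hu hv (by linarith : 0 < n)]

lemma mul_div_add_le_left (hu : 0 < u) (hv : 0 < v) : u * v / (u + v) ≤ u :=
  (div_le_iff₀ (by linarith)).2 (by nlinarith)

lemma one_lt_mul_of_energy_lt (hκ : 1 ≤ κ) (hq : 1 ≤ q) (hu : 0 < u) (hv : 0 < v)
    (hn : u + v ≤ n) (hE : κ ^ 2 * lenThreshold n q u v < D * (u * v / (u + v))) :
    1 < n * D := by
  have hthr : q ≤ lenThreshold n q u v := le_lenThreshold_of_add_le hu hv hn
  have hE' : 1 < D * (u * v / (u + v)) := by nlinarith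
  have hD : 0 < D := pos_of_mul_pos_left (by linarith) (by positivity)
  have hlen : u * v / (u + v) ≤ n := (mul_div_add_le_left hu hv).trans (by linarith)
  nlinarith

lemma detectionRadius_pos (hκ : 1 ≤ κ) (hq : 1 ≤ q) (hu : 0 < u) (hv : 0 < v) (hn : u + v ≤ n)
    (hE : κ ^ 2 * lenThreshold n q u v < D * (u * v / (u + v))) :
    0 < detectionRadius κ q n D u v := by
  have hnD := one_lt_mul_of_energy_lt hκ hq hu hv hn hE
  have hD : 0 < D := pos_of_mul_pos_right (by linarith) (by linarith : 0 ≤ n)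
  have hlog := Real.log_pos hnD
  refine lt_min (by linarith) (lt_min (by linarith) ?_)
  positivity

lemma mul_add_log_half_le (hL : 1 < L) (hq : 3 ≤ q) (hu : 0 < u) (hv : 0 < v) (hn : u + v ≤ n)
    (hE : (64 * L) ^ 2 * lenThreshold n q u v < D * (u * v / (u + v))) :
    64 * L * (q + Real.log (n / (u / 2))) ≤ D * (u / 2) := by
  have hn0 : 0 < n := by linarith
  have hthr : q ≤ lenThreshold n q u v := le_lenThreshold_of_add_le hu hv hn
  have hlog := le_lenThreshold (q := q) hu hv hn0
  have hlog2 : Real.log 2 ≤ 1 := by linarith [Real.log_two_lt_d9]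
  have hsplit : Real.log (n / (u / 2)) = Real.log (n / u) + Real.log 2 := by
    rw [← Real.log_mul (by positivity) (by norm_num)]
    congr 1
    field_simp
  have hD : 0 < D :=
    pos_of_mul_pos_left ((mul_nonneg (sq_nonneg _) (by linarith)).trans_lt hE) (by positivity)
  calc 64 * L * (q + Real.log (n / (u / 2)))
      ≤ 64 * L * (2 * lenThreshold n q u v) := by gcongr; linarith
    _ ≤ (64 * L) ^ 2 * lenThreshold n q u v / 2 := by
        have hnonneg : 0 ≤ lenThreshold n q u v := by linarith
        nlinarith [mul_nonneg (mul_nonneg (zero_le_one.trans hL.le) (sub_pos.2 hL).le) hnonneg]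
    _ ≤ D * u / 2 := by
        have := mul_le_mul_of_nonneg_left (mul_div_add_le_left hu hv) hD.le
        linarith
    _ = D * (u / 2) := mul_div_assoc D u 2

lemma mul_add_log_le_mul_self (hκ : 1 ≤ κ) (hq : 1 ≤ q) (hn : 0 < n) (hnD : 1 < n * D) :
    κ * (q + Real.log (n / (κ * ((Real.log (n * D) + q) / D))))
      ≤ D * (κ * ((Real.log (n * D) + q) / D)) := by
  have hD : 0 < D := pos_of_mul_pos_right (by linarith) hn.le
  have hlog := Real.log_pos hnD
  have hle : n / (κ * ((Real.log (n * D) + q) / D)) ≤ n * D := by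
    have hone : 1 ≤ κ * (Real.log (n * D) + q) := by nlinarith
    rw [← mul_div_assoc, div_div_eq_mul_div]
    exact div_le_self (by positivity) hone
  calc κ * (q + Real.log (n / (κ * ((Real.log (n * D) + q) / D))))
      ≤ κ * (q + Real.log (n * D)) := by gcongr
    _ = D * (κ * ((Real.log (n * D) + q) / D)) := by field_simp; ring

lemma mul_add_log_div_detectionRadius_le (hL : 1 < L) (hq : 3 ≤ q) (hu : 0 < u) (hv : 0 < v)
    (hn : u + v ≤ n) (hE : (64 * L) ^ 2 * lenThreshold n q u v < D * (u * v / (u + v))) :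
    64 * L * (q + Real.log (n / detectionRadius (64 * L) q n D u v))
      ≤ D * detectionRadius (64 * L) q n D u v := by
  unfold detectionRadius
  rcases min_choice (v / 2) (min (u / 2) (64 * L * ((Real.log (n * D) + q) / D))) with h | h <;>
    rw [h]
  · rw [lenThreshold_comm, mul_comm u, add_comm u] at hE
    exact mul_add_log_half_le hL hq hv hu (by linarith) hE
  rcases min_choice (u / 2) (64 * L * ((Real.log (n * D) + q) / D)) with h | h <;> rw [h]
  · exact mul_add_log_half_le hL hq hu hv hn hE
  · exact mul_add_log_le_mul_self (by linarith) (by linarith) (by linarith)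
      (one_lt_mul_of_energy_lt (by linarith) (by linarith) hu hv hn hE)

end DetectionRadius

section Detection

variable {n a b c p r t m : ℕ} {C L q : ℝ} {θ e Y : EuclideanSpace ℝ (Fin n)} {T : Finset ℕ}

/-- An upper bound of the squared threshold of two segments whose lengths are at least `m / 2`. -/
noncomputable def scaleThreshold (n : ℕ) (q : ℝ) (m : ℕ) : ℝ := q + 2 * Real.log (4 * n / m)

lemma scaleThreshold_nonneg (hq : 0 ≤ q) (hm : 1 ≤ m) (hmn : m ≤ n) :
    0 ≤ scaleThreshold n q m := by
  have hm0 : (0 : ℝ) < m := by exact_mod_cast hm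
  have hmn' : (m : ℝ) ≤ n := Nat.cast_le.2 hmn
  have hlog : 0 ≤ Real.log (4 * n / m) := Real.log_nonneg ((one_le_div hm0).2 (by linarith))
  rw [scaleThreshold]
  linarith

lemma half_le_sub_of_two_mul_add_le (h : 2 * a + m ≤ 2 * b) : (m : ℝ) / 2 ≤ (b : ℝ) - a := by
  have hcast : (2 * a + m : ℝ) ≤ 2 * b := by exact_mod_cast h
  linarith

lemma IsTriad.sqThreshold_le (h : IsTriad n a b c) (q : ℝ) (hm : 1 ≤ m)
    (hab : 2 * a + m ≤ 2 * b) (hbc : 2 * b + m ≤ 2 * c) :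
    sqThreshold n q a b c ≤ scaleThreshold n q m := by
  have : (0 : ℝ) < m := by exact_mod_cast hm
  have hab0 := h.left_pos
  have hbc0 := h.right_pos
  have hac0 := h.pos
  have hn := h.natCast_pos
  have hlog : Real.log (((n : ℝ) * ((c : ℝ) - a)) / (((c : ℝ) - b) * ((b : ℝ) - a)))
      ≤ Real.log (4 * n / m) := by
    refine Real.log_le_log (by positivity) ?_
    calc ((n : ℝ) * ((c : ℝ) - a)) / (((c : ℝ) - b) * ((b : ℝ) - a))
        = n / ((b : ℝ) - a) + n / ((c : ℝ) - b) := by field_simp; ring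
      _ ≤ n / (m / 2) + n / (m / 2) := by
          gcongr
          exacts [half_le_sub_of_two_mul_add_le hab, half_le_sub_of_two_mul_add_le hbc]
      _ = 4 * n / m := by field_simp; ring
  rw [sqThreshold, scaleThreshold]
  linarith

lemma crit_insert_add_contrast_sq_le (hL : 0 ≤ L) (Y : EuclideanSpace ℝ (Fin n))
    (hT : IsCPVector n T) (h2 : 2 ≤ t) (hn : t ≤ n) (ht : t ∉ T) (hm : 1 ≤ m)
    (hprev : 2 * prevPt T t + m ≤ 2 * t) (hnext : 2 * t + m ≤ 2 * nextPt n T t) :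
    crit L q Y (insert t T) + contrast Y (prevPt T t) t (nextPt n T t) ^ 2
      ≤ crit L q Y T + L * scaleThreshold n q m := by
  rw [crit_insert L q Y hT h2 hn ht]
  have hthr := mul_le_mul_of_nonneg_left
    ((isTriad_prevPt_nextPt T h2 hn).sqThreshold_le q hm hprev hnext) hL
  linarith

lemma exists_le_prevPt (hL : 0 ≤ L) (hm : 1 ≤ m) (hQ : 0 ≤ scaleThreshold n q m)
    (Y : EuclideanSpace ℝ (Fin n)) (hT : IsCPVector n T) (ht : t ∉ T) (h2 : 2 ≤ t) (hn : t ≤ n)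
    (hprev : prevPt T t + m ≤ t) (hnext : 2 * t + m ≤ 2 * nextPt n T t) (hp : p + m ≤ t) :
    ∃ T', IsCPVector n T' ∧ t ∉ T' ∧ p ≤ prevPt T' t ∧ 2 * prevPt T' t + m ≤ 2 * t ∧
      nextPt n T' t = nextPt n T t ∧ crit L q Y T' ≤ crit L q Y T + L * scaleThreshold n q m := by
  by_cases hpT : p ≤ prevPt T t
  · exact ⟨T, hT, ht, hpT, by omega, rfl, le_add_of_nonneg_right (mul_nonneg hL hQ)⟩
  have h1 := (isTriad_prevPt_nextPt T h2 hn).one_le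
  obtain ⟨x, hx⟩ : ∃ x, x = t - (m + 1) / 2 := ⟨_, rfl⟩
  have hxt : x < t := by omega
  have hxT : prevPt T t < x := by omega
  have hcrit := crit_insert_add_contrast_sq_le (q := q) hL Y hT (by omega) (by omega)
    (notMem_of_prevPt_lt hxT hxt) hm (by rw [prevPt_eq_of_prevPt_lt h2 hxT hxt]; omega)
    (by rw [nextPt_eq_of_prevPt_lt_of_notMem hn ht hxT hxt]; omega)
  refine ⟨insert x T, hT.insert (by omega) (by omega), by simp [hxt.ne', ht], ?_, ?_,
    nextPt_insert_of_le n T hxt.le, by nlinarith⟩ <;>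
  · rw [prevPt_insert_of_prevPt_lt hxT hxt]
    omega

lemma exists_nextPt_le (hL : 0 ≤ L) (hm : 1 ≤ m) (hQ : 0 ≤ scaleThreshold n q m)
    (Y : EuclideanSpace ℝ (Fin n)) (hT : IsCPVector n T) (ht : t ∉ T) (h2 : 2 ≤ t) (hn : t ≤ n)
    (hprev : 2 * prevPt T t + m ≤ 2 * t) (hnext : t + m ≤ nextPt n T t) (hr : t + m ≤ r) :
    ∃ T', IsCPVector n T' ∧ t ∉ T' ∧ nextPt n T' t ≤ r ∧ 2 * t + m ≤ 2 * nextPt n T' t ∧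
      prevPt T' t = prevPt T t ∧ crit L q Y T' ≤ crit L q Y T + L * scaleThreshold n q m := by
  by_cases hrT : nextPt n T t ≤ r
  · exact ⟨T, hT, ht, hrT, by omega, rfl, le_add_of_nonneg_right (mul_nonneg hL hQ)⟩
  have hc := (isTriad_prevPt_nextPt T h2 hn).le_succ
  obtain ⟨x, hx⟩ : ∃ x, x = t + (m + 1) / 2 := ⟨_, rfl⟩
  have htx : t < x := by omega
  have hxT : x < nextPt n T t := by omega
  have hcrit := crit_insert_add_contrast_sq_le (q := q) hL Y hT (by omega) (by omega)
    (notMem_of_lt_nextPt htx hxT) hm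
    (by rw [prevPt_eq_of_lt_nextPt_of_notMem h2 ht htx hxT]; omega)
    (by rw [nextPt_eq_of_lt_nextPt hn htx hxT]; omega)
  refine ⟨insert x T, hT.insert (by omega) (by omega), by simp [htx.ne, ht], ?_, ?_,
    prevPt_insert_of_le T htx.le, by nlinarith⟩ <;>
  · rw [nextPt_insert_of_lt_nextPt (by omega) htx hxT]
    omega

/-- The estimator is compared with the change-point vector in which `t` is inserted together with
up to two auxiliary entries, at distance about `m / 2`, that confine the contrast at `t` to
`[p, r)`. -/
lemma IsPLSE.exists_contrast_sq_le (h : IsPLSE L q Y T) (hL : 0 ≤ L) (hq : 0 ≤ q) (ht : t ∉ T)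
    (h2 : 2 ≤ t) (hn : t ≤ n) (hm : 1 ≤ m) (hp : p + m ≤ t) (hr : t + m ≤ r)
    (hprev : prevPt T t + m ≤ t) (hnext : t + m ≤ nextPt n T t) :
    ∃ a c, IsTriad n a t c ∧ p ≤ a ∧ c ≤ r ∧ 2 * a + m ≤ 2 * t ∧ 2 * t + m ≤ 2 * c ∧
      contrast Y a t c ^ 2 ≤ 3 * (L * scaleThreshold n q m) := by
  have hQ := scaleThreshold_nonneg hq hm (by omega : m ≤ n)
  obtain ⟨T₁, hT₁, ht₁, hp₁, hprev₁, hnext₁, hcrit₁⟩ :=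
    exists_le_prevPt hL hm hQ Y h.1 ht h2 hn hprev (by omega) hp
  obtain ⟨T₂, hT₂, ht₂, hr₂, hnext₂, hprev₂, hcrit₂⟩ :=
    exists_nextPt_le hL hm hQ Y hT₁ ht₁ h2 hn hprev₁ (by omega) hr
  have hcrit := crit_insert_add_contrast_sq_le (q := q) hL Y hT₂ h2 hn ht₂ hm (by omega) hnext₂
  have hmin := h.2 _ (hT₂.insert h2 hn)
  exact ⟨_, _, isTriad_prevPt_nextPt T₂ h2 hn, by omega, hr₂, by omega, hnext₂, by linarith⟩

lemma IsTriad.contrast_sq_eq_height_sq_mul (h : IsTriad n a b c)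
    (hl : ∀ j, a < j → j < b → j ∉ trueCP θ) (hr : ∀ j, b < j → j < c → j ∉ trueCP θ) :
    contrast θ a b c ^ 2
      = height θ b ^ 2 * ((((b : ℝ) - a) * ((c : ℝ) - b)) / ((c : ℝ) - a)) := by
  have hab := h.left_lt
  have hbc := h.lt_right
  have hcn := h.le_succ
  have ha := h.one_le
  have hleft {k : ℕ} : a ≤ k → k < b → coord θ k = coord θ a :=
    coord_eq_of_forall_notMem_trueCP ha (by omega) hl
  have hmean : segMean θ a b = coord θ (b - 1) := by
    rw [hleft (by omega : a ≤ b - 1) (by omega)]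
    exact segMean_eq_of_forall θ hab fun k => hleft
  rw [h.contrast_sq, hmean, height, segMean_eq_of_forall θ hbc fun k =>
    coord_eq_of_forall_notMem_trueCP (by omega) hcn hr]

lemma IsPLSE.height_sq_mul_le (h : IsPLSE L q (θ + e) T) (hL : 0 ≤ L) (hq : 0 ≤ q)
    (he : ContrastsBounded L q e) (ht : t ∉ T) (h2 : 2 ≤ t) (hn : t ≤ n) (hm : 1 ≤ m)
    (hp : p + m ≤ t) (hr : t + m ≤ r) (hprev : prevPt T t + m ≤ t) (hnext : t + m ≤ nextPt n T t)
    (hθl : ∀ j, p < j → j < t → j ∉ trueCP θ) (hθr : ∀ j, t < j → j < r → j ∉ trueCP θ) :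
    height θ t ^ 2 * m ≤ 32 * (L * scaleThreshold n q m) := by
  obtain ⟨a, c, htri, hpa, hcr, hta, htc, hobs⟩ :=
    h.exists_contrast_sq_le hL hq ht h2 hn hm hp hr hprev hnext
  have hnoise : contrast e a t c ^ 2 ≤ L * scaleThreshold n q m :=
    (he a t c htri).trans (mul_le_mul_of_nonneg_left (htri.sqThreshold_le q hm hta htc) hL)
  have hsignal : contrast θ a t c ^ 2 ≤ 8 * (L * scaleThreshold n q m) := by
    rw [contrast_add] at hobs
    nlinarith [sq_nonneg (contrast θ a t c + 2 * contrast e a t c)]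
  rw [htri.contrast_sq_eq_height_sq_mul (fun j hj => hθl j (by omega))
    (fun j hj hjc => hθr j hj (by omega))] at hsignal
  have hleft := half_le_sub_of_two_mul_add_le hta
  have hright := half_le_sub_of_two_mul_add_le htc
  have : (0 : ℝ) ≤ m := Nat.cast_nonneg m
  have hlen : (m : ℝ) / 4 ≤ ((t : ℝ) - a) * ((c : ℝ) - t) / ((c : ℝ) - a) := by
    rw [le_div_iff₀ htri.pos]
    nlinarith
  linarith [mul_le_mul_of_nonneg_left hlen (sq_nonneg (height θ t))]

lemma mul_lenThreshold_lt_of_isHighEnergy {κ : ℝ} (hκ : 0 ≤ κ) (hq : 0 ≤ q) (ht : t ∈ trueCP θ)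
    (hE : IsHighEnergy θ κ q (trueCP θ) t) {u v : ℝ} (hu : u = (t : ℝ) - prevPt (trueCP θ) t)
    (hv : v = (nextPt n (trueCP θ) t : ℝ) - t) :
    κ ^ 2 * lenThreshold n q u v < height θ t ^ 2 * (u * v / (u + v)) := by
  have htri := isTriad_prevPt_nextPt (trueCP θ) ((isCPVector_trueCP θ).two_le ht)
    ((isCPVector_trueCP θ).le ht)
  have hsq := pow_lt_pow_left₀ hE.2 (mul_nonneg hκ (Real.sqrt_nonneg _)) two_ne_zero
  rw [mul_pow, htri.threshold_sq hq, sqThreshold_eq_lenThreshold, energy_eq_abs_contrast, sq_abs,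
    htri.contrast_sq_eq_height_sq_mul (fun j => notMem_of_prevPt_lt)
      (fun j => notMem_of_lt_nextPt), ← hu, ← hv] at hsq
  rwa [show u + v = (nextPt n (trueCP θ) t : ℝ) - prevPt (trueCP θ) t by rw [hu, hv]; ring]

lemma add_floor_succ_le_of_lt_sub {ρ : ℝ} (hρ : 0 ≤ ρ) (h : ρ < (b : ℝ) - a) :
    a + (⌊ρ⌋₊ + 1) ≤ b := by
  have hcast : (a : ℝ) + ⌊ρ⌋₊ < b := by linarith [Nat.floor_le hρ]
  have hlt : a + ⌊ρ⌋₊ < b := by exact_mod_cast hcast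
  omega

lemma scaleThreshold_floor_succ_le {ρ : ℝ} (hρ : 0 < ρ) (hn : 0 < n) (hq : 3 ≤ q) :
    scaleThreshold n q (⌊ρ⌋₊ + 1) ≤ 2 * (q + Real.log (n / ρ)) := by
  have : (0 : ℝ) < n := Nat.cast_pos.2 hn
  have hlog : Real.log (4 * n / (⌊ρ⌋₊ + 1 : ℕ)) ≤ Real.log 4 + Real.log (n / ρ) := by
    rw [← Real.log_mul (by norm_num) (by positivity), ← mul_div_assoc]
    gcongr
    exact_mod_cast (Nat.lt_floor_add_one ρ).le
  have hlog4 : Real.log 4 ≤ 3 / 2 := by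
    rw [show (4 : ℝ) = 2 ^ 2 by norm_num, Real.log_pow, Nat.cast_ofNat]
    linarith [Real.log_two_lt_d9]
  rw [scaleThreshold]
  linarith

lemma lt_sub_prevPt_of_lt_distH1 {ρ : ℝ} (h : (ρ : EReal) < distH1 T t) (h2 : 2 ≤ t)
    (h1 : ρ < (t : ℝ) - 1) : ρ < (t : ℝ) - prevPt T t := by
  rcases prevPt_eq_one_or_mem T h2 with hprev | hprev
  · rwa [hprev, Nat.cast_one]
  · have hlt : (prevPt T t : ℝ) < t := Nat.cast_lt.2 (prevPt_lt T h2)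
    have hdist := EReal.coe_lt_coe_iff.1 (h.trans_le (Finset.inf_le hprev))
    rwa [abs_sub_comm, abs_of_pos (sub_pos.2 hlt)] at hdist

lemma lt_nextPt_sub_of_lt_distH1 {ρ : ℝ} (h : (ρ : EReal) < distH1 T t) (hn : t ≤ n)
    (h1 : ρ < (n + 1 : ℝ) - t) : ρ < (nextPt n T t : ℝ) - t := by
  rcases nextPt_mem_or_eq T hn with hnext | hnext
  · have hlt : (t : ℝ) < nextPt n T t := Nat.cast_lt.2 (lt_nextPt T hn)
    have hdist := EReal.coe_lt_coe_iff.1 (h.trans_le (Finset.inf_le hnext))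
    rwa [abs_of_pos (sub_pos.2 hlt)] at hdist
  · rwa [hnext, Nat.cast_succ]

lemma IsPLSE.detec (h : IsPLSE L q (θ + e) T) (hL : 1 < L) (hq : 3 ≤ q)
    (he : ContrastsBounded L q e) : Detec θ (64 * L) q (64 * L) T := by
  intro t ht hE
  have h2 := (isCPVector_trueCP θ).two_le ht
  have hn := (isCPVector_trueCP θ).le ht
  have htri := isTriad_prevPt_nextPt (trueCP θ) h2 hn
  have hE' := mul_lenThreshold_lt_of_isHighEnergy (by linarith) (by linarith) ht hE rfl rfl
  have hlen : ((t : ℝ) - prevPt (trueCP θ) t) + ((nextPt n (trueCP θ) t : ℝ) - t) ≤ n := by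
    linarith [htri.length_le]
  set u := (t : ℝ) - prevPt (trueCP θ) t
  set v := (nextPt n (trueCP θ) t : ℝ) - t
  have hu : 0 < u := htri.left_pos
  have hv : 0 < v := htri.right_pos
  change distH1 T t ≤ (detectionRadius (64 * L) q n (height θ t ^ 2) u v : EReal)
  have hρ0 := detectionRadius_pos (by linarith) (by linarith) hu hv hlen hE'
  have hρ := mul_add_log_div_detectionRadius_le hL hq hu hv hlen hE'
  have hρv : detectionRadius (64 * L) q n (height θ t ^ 2) u v ≤ v / 2 := min_le_left _ _
  have hρu : detectionRadius (64 * L) q n (height θ t ^ 2) u v ≤ u / 2 :=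
    (min_le_right _ _).trans (min_le_left _ _)
  set ρ := detectionRadius (64 * L) q n (height θ t ^ 2) u v
  by_contra! hfar
  have htT : t ∉ T := fun hmem => hρ0.not_ge <| by
    simpa using (EReal.coe_lt_coe_iff.1 (hfar.trans_le (Finset.inf_le hmem))).le
  have hp1 : (1 : ℝ) ≤ prevPt (trueCP θ) t := Nat.one_le_cast.2 htri.one_le
  have hrn : (nextPt n (trueCP θ) t : ℝ) ≤ n + 1 := by exact_mod_cast htri.le_succ
  have hheight := h.height_sq_mul_le (m := ⌊ρ⌋₊ + 1) (by linarith) (by linarith) he htT h2 hn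
    (Nat.le_add_left 1 _) (add_floor_succ_le_of_lt_sub hρ0.le (by linarith : ρ < u))
    (add_floor_succ_le_of_lt_sub hρ0.le (by linarith : ρ < v))
    (add_floor_succ_le_of_lt_sub hρ0.le (lt_sub_prevPt_of_lt_distH1 hfar h2 (by linarith)))
    (add_floor_succ_le_of_lt_sub hρ0.le (lt_nextPt_sub_of_lt_distH1 hfar hn (by linarith)))
    (fun j => notMem_of_prevPt_lt) (fun j => notMem_of_lt_nextPt)
  have hscale := mul_le_mul_of_nonneg_left
    (scaleThreshold_floor_succ_le hρ0 (by omega : 0 < n) hq) (by linarith : 0 ≤ L)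
  have hD : 0 < height θ t ^ 2 := pow_two_pos_of_ne_zero
    (sub_ne_zero.2 (Finset.mem_filter.1 ht).2.symm)
  have hfloor := mul_lt_mul_of_pos_left (Nat.lt_floor_add_one ρ) hD
  push_cast at hheight
  linarith

end Detection

section LogScale

variable {n q x y η : ℝ}

/-- The scale `x (q + log (n / x))` of the square of a sum of `x` noise variables. -/
noncomputable def logScale (n q x : ℝ) : ℝ := x * (q + Real.log (n / x))

lemma logScale_nonneg (hq : 0 ≤ q) (hx : 0 < x) (hxn : x ≤ n) : 0 ≤ logScale n q x := by
  have := Real.log_nonneg ((one_le_div hx).2 hxn)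
  unfold logScale
  positivity

lemma logScale_mono (hq : 1 ≤ q) (hx : 0 < x) (hxy : x ≤ y) (hyn : y ≤ n) :
    logScale n q x ≤ logScale n q y := by
  have hy : 0 < y := hx.trans_le hxy
  have hlogy : 0 ≤ Real.log (n / y) := Real.log_nonneg ((one_le_div hy).2 hyn)
  have hlogx : Real.log (n / x) = Real.log (n / y) + Real.log (y / x) := by
    rw [← Real.log_mul (div_pos (hy.trans_le hyn) hy).ne' (div_pos hy hx).ne',
      div_mul_div_cancel₀ hy.ne']
  have hdiff : x * Real.log (y / x) ≤ y - x := by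
    calc x * Real.log (y / x) ≤ x * (y / x - 1) := by
          gcongr
          exact Real.log_le_sub_one_of_pos (div_pos hy hx)
      _ = y - x := by field_simp
  rw [logScale, logScale, hlogx]
  nlinarith [mul_nonneg (sub_nonneg.2 hxy) hlogy, mul_nonneg (sub_nonneg.2 hxy) (sub_nonneg.2 hq)]

lemma five_mul_sqrt_logScale_le (hq : 3 ≤ q) (hx : 0 < x) (hxn : 2 * x ≤ n) :
    5 * √(logScale n q x) ≤ 4 * √(logScale n q (2 * x)) := by
  have hn : 0 < n := by linarith
  have hlog : Real.log (n / x) = Real.log (n / (2 * x)) + Real.log 2 := by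
    rw [← Real.log_mul (by positivity) (by norm_num)]
    congr 1
    field_simp
  have hlog0 : 0 ≤ Real.log (n / (2 * x)) :=
    Real.log_nonneg ((one_le_div (by positivity)).2 hxn)
  have hsq : 5 ^ 2 * logScale n q x ≤ 4 ^ 2 * logScale n q (2 * x) := by
    rw [logScale, logScale, hlog]
    nlinarith [Real.log_two_lt_d9]
  have hsqrt := Real.sqrt_le_sqrt hsq
  rwa [Real.sqrt_mul (by norm_num), Real.sqrt_mul (by norm_num), Real.sqrt_sq (by norm_num),
    Real.sqrt_sq (by norm_num)] at hsqrt

lemma logScale_sq_mul_le (hη : 0 < η) (hηq : Real.log ((η ^ 2)⁻¹) ≤ q) (hx : 0 < x)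
    (hxn : x ≤ n) : logScale n q (η ^ 2 * x) ≤ 2 * (η ^ 2 * logScale n q x) := by
  have hn : 0 < n := hx.trans_le hxn
  have hlog : Real.log (n / (η ^ 2 * x)) = Real.log (n / x) + Real.log ((η ^ 2)⁻¹) := by
    rw [← Real.log_mul (by positivity) (by positivity)]
    congr 1
    field_simp
  have hlog0 : 0 ≤ Real.log (n / x) := Real.log_nonneg ((one_le_div hx).2 hxn)
  rw [logScale, logScale, hlog]
  calc η ^ 2 * x * (q + (Real.log (n / x) + Real.log ((η ^ 2)⁻¹)))
      ≤ η ^ 2 * x * (2 * (q + Real.log (n / x))) := by gcongr; linarith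
    _ = 2 * (η ^ 2 * (x * (q + Real.log (n / x)))) := by ring

end LogScale

section Chaining

variable {S : ℕ → ℝ} {n : ℕ} {q : ℝ} {s t : ℕ}

/-- The increments of `S` over the dyadic blocks are controlled by their scale. -/
def DyadicBounded (S : ℕ → ℝ) (n : ℕ) (q : ℝ) : Prop :=
  ∀ j β : ℕ, (β + 1) * 2 ^ j ≤ n →
    |S ((β + 1) * 2 ^ j) - S (β * 2 ^ j)| ≤ 2 * √(logScale n q (2 ^ j))

/-- All increments of `S` are controlled by their scale. -/
def IncrementsBounded (S : ℕ → ℝ) (n : ℕ) (q : ℝ) : Prop :=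
  ∀ s t : ℕ, s < t → t ≤ n → (S t - S s) ^ 2 ≤ 400 * logScale n q ((t : ℝ) - s)

lemma natCast_sub_pos {a b : ℕ} (h : a < b) : (0 : ℝ) < (b : ℝ) - a := sub_pos.2 (Nat.cast_lt.2 h)

lemma natCast_sub_le {a b : ℕ} (h : b ≤ n) : (b : ℝ) - a ≤ n := by
  have hb : (b : ℝ) ≤ n := Nat.cast_le.2 h
  linarith [(Nat.cast_nonneg a : (0 : ℝ) ≤ a)]

lemma two_pow_log_le_sub (h : s < t) : (2 : ℝ) ^ Nat.log 2 (t - s) ≤ (t : ℝ) - s := by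
  rw [← Nat.cast_sub h.le]
  exact_mod_cast Nat.pow_log_le_self 2 (Nat.sub_pos_of_lt h).ne'

lemma lt_add_two_pow_log_succ (s t : ℕ) : t < s + 2 ^ (Nat.log 2 (t - s) + 1) := by
  have := Nat.lt_pow_succ_log_self Nat.one_lt_two (t - s)
  omega

lemma DyadicBounded.abs_sub_floor_succ_le (h : DyadicBounded S n q) (ht : t ≤ n) (j : ℕ) :
    |S (t / 2 ^ j * 2 ^ j) - S (t / 2 ^ (j + 1) * 2 ^ (j + 1))|
      ≤ 2 * √(logScale n q (2 ^ j)) := by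
  have hparent : t / 2 ^ (j + 1) * 2 ^ (j + 1) = 2 * (t / 2 ^ j / 2) * 2 ^ j := by
    rw [pow_succ, Nat.div_div_eq_div_mul]
    ring
  rw [hparent]
  rcases Nat.even_or_odd (t / 2 ^ j) with heven | hodd
  · rw [Nat.mul_div_cancel' heven.two_dvd, sub_self, abs_zero]
    positivity
  · have hblock := h j (2 * (t / 2 ^ j / 2))
    rw [Nat.two_mul_div_two_add_one_of_odd hodd] at hblock
    exact hblock ((Nat.div_mul_le_self t (2 ^ j)).trans ht)

lemma DyadicBounded.abs_sub_floor_le (h : DyadicBounded S n q) (hq : 3 ≤ q) (ht : t ≤ n) (j : ℕ)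
    (hj : 2 ^ j ≤ n) : |S t - S (t / 2 ^ j * 2 ^ j)| ≤ 8 * √(logScale n q (2 ^ j)) := by
  induction j with
  | zero => simp
  | succ j ih =>
    have hj' : 2 ^ j ≤ n := (Nat.pow_le_pow_right two_pos j.le_succ).trans hj
    have hgrow := five_mul_sqrt_logScale_le (n := n) (x := 2 ^ j) hq (by positivity)
      (by rw [← pow_succ']; exact_mod_cast hj)
    rw [← pow_succ'] at hgrow
    linarith [ih hj', h.abs_sub_floor_succ_le ht j,
      abs_sub_le (S t) (S (t / 2 ^ j * 2 ^ j)) (S (t / 2 ^ (j + 1) * 2 ^ (j + 1)))]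

lemma DyadicBounded.abs_sub_le_of_le_add_two (h : DyadicBounded S n q) {j β γ : ℕ} (hβ : β ≤ γ)
    (hγ : γ ≤ β + 2) (hn : γ * 2 ^ j ≤ n) :
    |S (γ * 2 ^ j) - S (β * 2 ^ j)| ≤ 4 * √(logScale n q (2 ^ j)) := by
  have hsqrt := Real.sqrt_nonneg (logScale n q (2 ^ j))
  obtain rfl | rfl | rfl : γ = β ∨ γ = β + 1 ∨ γ = β + 1 + 1 := by omega
  · rw [sub_self, abs_zero]
    positivity
  · linarith [h j β hn]
  · have hmid : (β + 1) * 2 ^ j ≤ n := (Nat.mul_le_mul_right _ (by omega)).trans hn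
    linarith [h j (β + 1) hn, h j β hmid,
      abs_sub_le (S ((β + 1 + 1) * 2 ^ j)) (S ((β + 1) * 2 ^ j)) (S (β * 2 ^ j))]

lemma DyadicBounded.incrementsBounded (h : DyadicBounded S n q) (hq : 3 ≤ q) :
    IncrementsBounded S n q := by
  intro s t hst ht
  set j := Nat.log 2 (t - s) with hj
  have hlen : (2 : ℝ) ^ j ≤ (t : ℝ) - s := two_pow_log_le_sub hst
  have hln : (t : ℝ) - s ≤ n := natCast_sub_le ht
  have hjn : 2 ^ j ≤ n := by exact_mod_cast hlen.trans hln
  have hfloor : t / 2 ^ j ≤ s / 2 ^ j + 2 := by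
    have hlt := lt_add_two_pow_log_succ s t
    rw [← hj, pow_succ'] at hlt
    exact (Nat.div_le_div_right hlt.le).trans_eq (Nat.add_mul_div_right _ _ (by positivity))
  have hmid := h.abs_sub_le_of_le_add_two (Nat.div_le_div_right hst.le) hfloor
    ((Nat.div_mul_le_self t (2 ^ j)).trans ht)
  have hleft := h.abs_sub_floor_le hq (hst.le.trans ht) j hjn
  rw [abs_sub_comm] at hleft
  have habs : |S t - S s| ≤ 20 * √(logScale n q (2 ^ j)) := by
    linarith [h.abs_sub_floor_le hq ht j hjn, abs_sub_le (S t) (S (t / 2 ^ j * 2 ^ j)) (S s),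
      abs_sub_le (S (t / 2 ^ j * 2 ^ j)) (S (s / 2 ^ j * 2 ^ j)) (S s)]
  calc (S t - S s) ^ 2 = |S t - S s| ^ 2 := (sq_abs _).symm
    _ ≤ (20 * √(logScale n q (2 ^ j))) ^ 2 := by gcongr
    _ = 400 * logScale n q (2 ^ j) := by
        rw [mul_pow, Real.sq_sqrt (logScale_nonneg (by linarith) (by positivity)
          (hlen.trans hln))]
        norm_num
    _ ≤ 400 * logScale n q ((t : ℝ) - s) := by
        gcongr
        exact logScale_mono (by linarith) (by positivity) hlen hln

end Chaining

section Rounding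

variable {S : ℕ → ℝ} {n : ℕ} {q d d' η : ℝ} {s s₀ t t₀ : ℕ}

/-- `s₀` is obtained from `s` by rounding down by at most `d`. -/
def IsRounding (d : ℝ) (s₀ s : ℕ) : Prop := s₀ ≤ s ∧ (s : ℝ) - s₀ ≤ d

lemma IsRounding.mono (h : IsRounding d s₀ s) (hd : d ≤ d') : IsRounding d' s₀ s :=
  ⟨h.1, h.2.trans hd⟩

lemma IsRounding.sub_sub_le (ht : IsRounding d t₀ t) (hs : s₀ ≤ s) :
    (t : ℝ) - s - d ≤ (t₀ : ℝ) - s₀ := by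
  have hs' : (s₀ : ℝ) ≤ s := Nat.cast_le.2 hs
  linarith [ht.2]

lemma abs_sq_div_sub_sq_div_le {A A₀ l l₀ r : ℝ} (hl : 0 < l) (hη : 0 ≤ η) (hη2 : η ≤ 1 / 2)
    (hr : 0 ≤ r) (hA : |A| ≤ 20 * r) (hAA₀ : |A - A₀| ≤ 60 * η * r)
    (hll₀ : |l₀ - l| ≤ η ^ 2 * l) :
    |A ^ 2 / l - A₀ ^ 2 / l₀| ≤ 12500 * η * (r ^ 2 / l) := by
  have hηr : η * r ≤ 1 / 2 * r := by gcongr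
  have hA₀ : |A₀| ≤ 50 * r := by
    have := abs_sub A (A - A₀)
    rw [sub_sub_cancel] at this
    linarith
  have hlower : l / 2 ≤ l₀ := by
    nlinarith [(abs_le.1 hll₀).1, mul_nonneg hη hl.le]
  have hl₀ : 0 < l₀ := by linarith
  have hnum : |A ^ 2 - A₀ ^ 2| ≤ 4200 * η * r ^ 2 := by
    rw [sq_sub_sq, abs_mul]
    calc |A + A₀| * |A - A₀| ≤ (70 * r) * (60 * η * r) := by
          gcongr
          linarith [abs_add_le A A₀]
      _ = 4200 * η * r ^ 2 := by ring
  have hden : |A₀ ^ 2 * ((l₀ - l) / l₀)| ≤ 2500 * η * r ^ 2 := by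
    have hratio : |l₀ - l| / l₀ ≤ η := by
      rw [div_le_iff₀ hl₀]
      nlinarith [mul_le_mul_of_nonneg_left hlower hη, mul_nonneg hη hl.le]
    rw [abs_mul, abs_div, abs_of_pos hl₀, abs_of_nonneg (sq_nonneg A₀), ← sq_abs A₀]
    calc |A₀| ^ 2 * (|l₀ - l| / l₀) ≤ (50 * r) ^ 2 * η := by gcongr
      _ = 2500 * η * r ^ 2 := by ring
  have hsplit : A ^ 2 / l - A₀ ^ 2 / l₀ = (A ^ 2 - A₀ ^ 2 + A₀ ^ 2 * ((l₀ - l) / l₀)) / l := by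
    field_simp
    ring
  rw [hsplit, abs_div, abs_of_pos hl, ← mul_div_assoc (12500 * η),
    div_le_div_iff_of_pos_right hl]
  nlinarith [abs_add_le (A ^ 2 - A₀ ^ 2) (A₀ ^ 2 * ((l₀ - l) / l₀)), mul_nonneg hη (sq_nonneg r)]

lemma IncrementsBounded.abs_sub_le_of_isRounding (h : IncrementsBounded S n q) (hq : 1 ≤ q)
    (hη : 0 < η) (hη1 : η ≤ 1) (hηq : Real.log ((η ^ 2)⁻¹) ≤ q) {l : ℝ} (hl : 0 < l) (hln : l ≤ n)
    (ht : t ≤ n) (htt₀ : IsRounding (η ^ 2 * l) t₀ t) :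
    |S t - S t₀| ≤ 30 * η * √(logScale n q l) := by
  rcases htt₀.1.eq_or_lt with rfl | hlt
  · rw [sub_self, abs_zero]
    positivity
  have hscale : 0 ≤ logScale n q l := logScale_nonneg (by linarith) hl hln
  refine abs_le_of_sq_le_sq ?_ (by positivity)
  rw [mul_pow, Real.sq_sqrt hscale]
  calc (S t - S t₀) ^ 2 ≤ 400 * logScale n q ((t : ℝ) - t₀) := h t₀ t hlt ht
    _ ≤ 400 * logScale n q (η ^ 2 * l) := by
        gcongr
        exact logScale_mono hq (natCast_sub_pos hlt) htt₀.2
          ((mul_le_of_le_one_left hl.le (pow_le_one₀ hη.le hη1)).trans hln)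
    _ ≤ 400 * (2 * (η ^ 2 * logScale n q l)) := by
        gcongr
        exact logScale_sq_mul_le hη hηq hl hln
    _ ≤ (30 * η) ^ 2 * logScale n q l := by nlinarith [mul_nonneg (sq_nonneg η) hscale]

lemma IncrementsBounded.abs_sq_div_sub_sq_div_le (h : IncrementsBounded S n q) (hq : 1 ≤ q)
    (hη : 0 < η) (hη2 : η ≤ 1 / 2) (hηq : Real.log ((η ^ 2)⁻¹) ≤ q) (hst : s < t) (ht : t ≤ n)
    (hs₀ : IsRounding (η ^ 2 * ((t : ℝ) - s)) s₀ s)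
    (ht₀ : IsRounding (η ^ 2 * ((t : ℝ) - s)) t₀ t) :
    |(S t - S s) ^ 2 / ((t : ℝ) - s) - (S t₀ - S s₀) ^ 2 / ((t₀ : ℝ) - s₀)|
      ≤ 12500 * η * (q + Real.log (n / ((t : ℝ) - s))) := by
  have hl : (0 : ℝ) < (t : ℝ) - s := natCast_sub_pos hst
  have hln : (t : ℝ) - s ≤ n := natCast_sub_le ht
  have hscale : 0 ≤ logScale n q ((t : ℝ) - s) := logScale_nonneg (by linarith) hl hln
  have hA : |S t - S s| ≤ 20 * √(logScale n q ((t : ℝ) - s)) := by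
    refine abs_le_of_sq_le_sq ?_ (by positivity)
    rw [mul_pow, Real.sq_sqrt hscale]
    linarith [h s t hst ht]
  have hAA₀ : |S t - S s - (S t₀ - S s₀)| ≤ 60 * η * √(logScale n q ((t : ℝ) - s)) := by
    rw [sub_sub_sub_comm]
    linarith [abs_sub (S t - S t₀) (S s - S s₀),
      h.abs_sub_le_of_isRounding hq hη (by linarith) hηq hl hln ht ht₀,
      h.abs_sub_le_of_isRounding hq hη (by linarith) hηq hl hln (hst.le.trans ht) hs₀]
  have hll₀ : |(t₀ : ℝ) - s₀ - ((t : ℝ) - s)| ≤ η ^ 2 * ((t : ℝ) - s) := by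
    have hs : (s₀ : ℝ) ≤ s := Nat.cast_le.2 hs₀.1
    have ht : (t₀ : ℝ) ≤ t := Nat.cast_le.2 ht₀.1
    exact abs_le.2 ⟨by linarith [ht₀.2], by linarith [hs₀.2]⟩
  refine (ChangePoint.abs_sq_div_sub_sq_div_le hl hη.le hη2 (Real.sqrt_nonneg _) hA hAA₀
    hll₀).trans_eq ?_
  rw [Real.sq_sqrt hscale, logScale, mul_div_cancel_left₀ _ hl.ne']

/-- The decrease of the residual sum of squares when the segment `(a, c]` is split after `b`, where
`S k` is the sum of the first `k` observations. -/
noncomputable def splitGain (S : ℕ → ℝ) (a b c : ℕ) : ℝ :=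
  (S b - S a) ^ 2 / ((b : ℝ) - a) + (S c - S b) ^ 2 / ((c : ℝ) - b)
    - (S c - S a) ^ 2 / ((c : ℝ) - a)

lemma add_log_div_le_lenThreshold {n u v l : ℝ} (hu : 0 < u) (hv : 0 < v) (hul : u ≤ l)
    (hln : l ≤ n) : q + Real.log (n / l) ≤ lenThreshold n q u v := by
  have hl : 0 < l := hu.trans_le hul
  have hn : 0 < n := hl.trans_le hln
  have hlog : Real.log (n / l) ≤ Real.log (n / u) := by gcongr
  linarith [le_lenThreshold (q := q) hu hv hn, Real.log_nonneg ((one_le_div hl).2 hln)]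

lemma IncrementsBounded.splitGain_le_add (h : IncrementsBounded S n q) (hq : 1 ≤ q) (hη : 0 < η)
    (hη2 : η ≤ 1 / 2) (hηq : Real.log ((η ^ 2)⁻¹) ≤ q) {a b c a₀ b₀ c₀ : ℕ} (hab : a < b)
    (hbc : b < c) (hc : c ≤ n) (ha₀ : IsRounding (η ^ 2 * ((b : ℝ) - a)) a₀ a)
    (hb₀ : IsRounding (η ^ 2 * min ((b : ℝ) - a) ((c : ℝ) - b)) b₀ b)
    (hc₀ : IsRounding (η ^ 2 * ((c : ℝ) - b)) c₀ c) :
    splitGain S a b c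
      ≤ splitGain S a₀ b₀ c₀ + 37500 * η * lenThreshold n q ((b : ℝ) - a) ((c : ℝ) - b) := by
  have hu := natCast_sub_pos hab
  have hv := natCast_sub_pos hbc
  have hleft := (h.abs_sq_div_sub_sq_div_le hq hη hη2 hηq hab (hbc.le.trans hc) ha₀
    (hb₀.mono (by gcongr; exact min_le_left _ _))).trans (mul_le_mul_of_nonneg_left
      (add_log_div_le_lenThreshold hu hv le_rfl (natCast_sub_le (hbc.le.trans hc)))
      (by positivity))
  have hright := (h.abs_sq_div_sub_sq_div_le hq hη hη2 hηq hbc hc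
    (hb₀.mono (by gcongr; exact min_le_right _ _)) hc₀).trans (mul_le_mul_of_nonneg_left
      (add_log_div_le_lenThreshold hv hu le_rfl (natCast_sub_le hc)) (by positivity))
  have hwhole := (h.abs_sq_div_sub_sq_div_le hq hη hη2 hηq (hab.trans hbc) hc
    (ha₀.mono (by gcongr)) (hc₀.mono (by gcongr))).trans (mul_le_mul_of_nonneg_left
      (add_log_div_le_lenThreshold hu hv (by gcongr) (natCast_sub_le hc)) (by positivity))
  rw [lenThreshold_comm] at hright
  unfold splitGain
  linarith [(abs_le.1 hleft).2, (abs_le.1 hright).2, (abs_le.1 hwhole).1]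

lemma lenThreshold_le_mul_of_le {n u v u₀ v₀ : ℝ} (hq : 1 ≤ q) (hη : 0 ≤ η) (hη2 : η ≤ 1 / 2)
    (hu : 0 < u) (hv : 0 < v) (hn : u + v ≤ n) (hu₀ : (1 - η ^ 2) * u ≤ u₀)
    (hv₀ : (1 - η ^ 2) * v ≤ v₀) :
    lenThreshold n q u₀ v₀ ≤ (1 + 4 * η) * lenThreshold n q u v := by
  have hδ : 0 < 1 - η ^ 2 := by nlinarith
  have hn0 : 0 < n := by linarith
  have hu₀0 : 0 < u₀ := (mul_pos hδ hu).trans_le hu₀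
  have hv₀0 : 0 < v₀ := (mul_pos hδ hv).trans_le hv₀
  have hratio : n * (u₀ + v₀) / (u₀ * v₀) ≤ n * (u + v) / (u * v) * (1 - η ^ 2)⁻¹ := by
    calc n * (u₀ + v₀) / (u₀ * v₀) = n / u₀ + n / v₀ := by field_simp; ring
      _ ≤ n / ((1 - η ^ 2) * u) + n / ((1 - η ^ 2) * v) := by gcongr
      _ = n * (u + v) / (u * v) * (1 - η ^ 2)⁻¹ := by field_simp; ring
  have hinv : Real.log (1 - η ^ 2)⁻¹ ≤ 2 * η := by
    have hle : (1 - η ^ 2)⁻¹ ≤ 1 + 2 * η := by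
      rw [inv_le_iff_one_le_mul₀ hδ]
      nlinarith
    linarith [Real.log_le_sub_one_of_pos (inv_pos.2 hδ)]
  have hlog := Real.log_le_log (by positivity) hratio
  rw [Real.log_mul (by positivity) (by positivity)] at hlog
  have hthr : lenThreshold n q u₀ v₀ ≤ lenThreshold n q u v + 4 * η := by
    rw [lenThreshold, lenThreshold]
    linarith
  nlinarith [le_lenThreshold_of_add_le (q := q) hu hv hn]

end Rounding

section Grid

variable {S : ℕ → ℝ} {n k i j a b c : ℕ} {q M ξ : ℝ}

/-- The mesh of the grid at the scale `2 ^ j` with relative precision `4⁻ᵏ`. -/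
def mesh (k j : ℕ) : ℕ := 2 ^ (j - 2 * k)

/-- The triples `(a, b, c)` of the grid of precision `k` whose two sides have at most the scales
`2 ^ i` and `2 ^ j`. The middle point is taken on the finer of the two grids. -/
def gridTriples (n k i j : ℕ) : Finset (ℕ × ℕ × ℕ) :=
  {t ∈ Finset.range (n + 1) ×ˢ Finset.range (n + 1) ×ˢ Finset.range (n + 1) |
    (mesh k i ∣ t.1 ∧ mesh k (min i j) ∣ t.2.1 ∧ mesh k j ∣ t.2.2) ∧
    (t.1 < t.2.1 ∧ t.2.1 < t.1 + 2 ^ (i + 2)) ∧ (t.2.1 < t.2.2 ∧ t.2.2 < t.2.1 + 2 ^ (j + 2))}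

/-- The gains of the splits along the triples of a multiscale grid are controlled. -/
def GridBounded (S : ℕ → ℝ) (n k : ℕ) (q M : ℝ) : Prop :=
  ∀ i ∈ Finset.range (Nat.log 2 n + 1), ∀ j ∈ Finset.range (Nat.log 2 n + 1),
    ∀ t ∈ gridTriples n k i j, splitGain S t.1 t.2.1 t.2.2
      ≤ M * lenThreshold n q ((t.2.1 : ℝ) - t.1) ((t.2.2 : ℝ) - t.2.1)

lemma mesh_pos (k j : ℕ) : 0 < mesh k j := Nat.two_pow_pos _

lemma mem_gridTriples :
    (a, b, c) ∈ gridTriples n k i j ↔ c ≤ n ∧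
      (mesh k i ∣ a ∧ mesh k (min i j) ∣ b ∧ mesh k j ∣ c) ∧
      (a < b ∧ b < a + 2 ^ (i + 2)) ∧ (b < c ∧ c < b + 2 ^ (j + 2)) := by
  simp only [gridTriples, Finset.mem_filter, Finset.mem_product, Finset.mem_range]
  omega

lemma isRounding_mesh_mul_div (k s : ℕ) {x : ℝ} (hx : (2 : ℝ) ^ j ≤ x) :
    IsRounding (((2 : ℝ) ^ k)⁻¹ ^ 2 * x) (mesh k j * (s / mesh k j)) s := by
  refine ⟨Nat.mul_div_le s _, ?_⟩
  have hx0 : 0 < x := lt_of_lt_of_le (by positivity) hx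
  rcases le_or_gt j (2 * k) with hjk | hjk
  · rw [mesh, Nat.sub_eq_zero_of_le hjk, pow_zero, Nat.div_one, one_mul, sub_self]
    positivity
  have hmod : (s : ℝ) ≤ (mesh k j * (s / mesh k j) : ℕ) + (mesh k j : ℕ) := by
    exact_mod_cast (Nat.lt_mul_div_succ s (mesh_pos k j)).le
  have hmesh : ((mesh k j : ℕ) : ℝ) * (2 ^ k) ^ 2 = 2 ^ j := by
    rw [mesh, Nat.cast_pow, Nat.cast_ofNat, ← pow_mul, ← pow_add]
    congr 1
    omega
  have hle : ((mesh k j : ℕ) : ℝ) ≤ ((2 : ℝ) ^ k)⁻¹ ^ 2 * x := by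
    rwa [inv_pow, ← div_eq_inv_mul, le_div_iff₀ (by positivity), hmesh]
  linarith

lemma IsRounding.lt_and_lt_add {a₀ b₀ : ℕ} {δ : ℝ} (hδ : δ < 1) (hab : a < b)
    (ha₀ : IsRounding (δ * ((b : ℝ) - a)) a₀ a) (hb₀ : IsRounding (δ * ((b : ℝ) - a)) b₀ b)
    (hb : b < a + 2 ^ (i + 1)) : a₀ < b₀ ∧ b₀ < a₀ + 2 ^ (i + 2) := by
  have hl := natCast_sub_pos hab
  have hlen := hb₀.sub_sub_le ha₀.1
  have hb' : (b : ℝ) < a + 2 ^ (i + 1) := by exact_mod_cast hb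
  have hbb₀ : (b₀ : ℝ) ≤ b := Nat.cast_le.2 hb₀.1
  have hlt : (a₀ : ℝ) < b₀ := by nlinarith
  have hlt' : (b₀ : ℝ) < a₀ + 2 ^ (i + 2) := by
    rw [pow_succ]
    nlinarith [ha₀.2]
  exact ⟨by exact_mod_cast hlt, by exact_mod_cast hlt'⟩

lemma exists_mem_gridTriples_isRounding (hk : 1 ≤ k) (hab : a < b) (hbc : b < c) (hc : c ≤ n) :
    ∃ i ∈ Finset.range (Nat.log 2 n + 1), ∃ j ∈ Finset.range (Nat.log 2 n + 1), ∃ a₀ b₀ c₀ : ℕ,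
      (a₀, b₀, c₀) ∈ gridTriples n k i j ∧
      IsRounding (((2 : ℝ) ^ k)⁻¹ ^ 2 * ((b : ℝ) - a)) a₀ a ∧
      IsRounding (((2 : ℝ) ^ k)⁻¹ ^ 2 * min ((b : ℝ) - a) ((c : ℝ) - b)) b₀ b ∧
      IsRounding (((2 : ℝ) ^ k)⁻¹ ^ 2 * ((c : ℝ) - b)) c₀ c := by
  set i := Nat.log 2 (b - a)
  set j := Nat.log 2 (c - b)
  have hδ : ((2 : ℝ) ^ k)⁻¹ ^ 2 < 1 :=
    pow_lt_one₀ (by positivity) (inv_lt_one_of_one_lt₀ (one_lt_pow₀ one_lt_two (by omega)))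
      two_ne_zero
  have hi := two_pow_log_le_sub hab
  have hj := two_pow_log_le_sub hbc
  have ha₀ := isRounding_mesh_mul_div k a hi
  have hc₀ := isRounding_mesh_mul_div k c hj
  have hb₀ := isRounding_mesh_mul_div (j := min i j) k b (le_min
    ((pow_le_pow_right₀ one_le_two (min_le_left i j)).trans hi)
    ((pow_le_pow_right₀ one_le_two (min_le_right i j)).trans hj))
  refine ⟨i, Finset.mem_range.2 (Nat.lt_succ_of_le (Nat.log_mono_right (by omega))), j,
    Finset.mem_range.2 (Nat.lt_succ_of_le (Nat.log_mono_right (by omega))), _, _, _,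
    mem_gridTriples.2 ⟨hc₀.1.trans hc,
      ⟨Dvd.intro _ rfl, Dvd.intro _ rfl, Dvd.intro _ rfl⟩, ?_, ?_⟩, ha₀, hb₀, hc₀⟩
  · exact ha₀.lt_and_lt_add hδ hab (hb₀.mono (by gcongr; exact min_le_left _ _))
      (lt_add_two_pow_log_succ a b)
  · exact IsRounding.lt_and_lt_add hδ hbc (hb₀.mono (by gcongr; exact min_le_right _ _)) hc₀
      (lt_add_two_pow_log_succ b c)

lemma GridBounded.splitGain_le (h : GridBounded S n k q (1 + ξ)) (hS : IncrementsBounded S n q)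
    (hq : 1 ≤ q) (hk : 1 ≤ k) (hξ1 : ξ ≤ 1) (hkξ : 40000 * ((2 : ℝ) ^ k)⁻¹ ≤ ξ)
    (hkq : Real.log ((((2 : ℝ) ^ k)⁻¹ ^ 2)⁻¹) ≤ q) (hab : a < b) (hbc : b < c) (hc : c ≤ n) :
    splitGain S a b c ≤ (1 + 2 * ξ) * lenThreshold n q ((b : ℝ) - a) ((c : ℝ) - b) := by
  obtain ⟨i, hi, j, hj, a₀, b₀, c₀, hmem, ha₀, hb₀, hc₀⟩ :=
    exists_mem_gridTriples_isRounding hk hab hbc hc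
  have hη : 0 < ((2 : ℝ) ^ k)⁻¹ := by positivity
  have hη2 : ((2 : ℝ) ^ k)⁻¹ ≤ 1 / 2 := by linarith
  set η := ((2 : ℝ) ^ k)⁻¹
  have hu := natCast_sub_pos hab
  have hv := natCast_sub_pos hbc
  have huv : (b : ℝ) - a + ((c : ℝ) - b) ≤ n := by
    rw [add_comm, sub_add_sub_cancel]
    exact natCast_sub_le hc
  have hleft := (hb₀.mono (d' := η ^ 2 * ((b : ℝ) - a))
    (by gcongr; exact min_le_left _ _)).sub_sub_le ha₀.1
  have hright := hc₀.sub_sub_le hb₀.1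
  have hnear := lenThreshold_le_mul_of_le (q := q) hq hη.le hη2 hu hv huv
    (u₀ := (b₀ : ℝ) - a₀) (v₀ := (c₀ : ℝ) - b₀) (by linarith) (by linarith)
  have hthr := le_lenThreshold_of_add_le (q := q) hu hv huv
  calc splitGain S a b c
      ≤ splitGain S a₀ b₀ c₀ + 37500 * η * lenThreshold n q ((b : ℝ) - a) ((c : ℝ) - b) :=
        hS.splitGain_le_add hq hη hη2 hkq hab hbc hc ha₀ hb₀ hc₀
    _ ≤ (1 + ξ) * ((1 + 4 * η) * lenThreshold n q ((b : ℝ) - a) ((c : ℝ) - b))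
          + 37500 * η * lenThreshold n q ((b : ℝ) - a) ((c : ℝ) - b) := by
        gcongr
        exact (h i hi j hj _ hmem).trans (mul_le_mul_of_nonneg_left hnear (by linarith))
    _ = ((1 + ξ) * (1 + 4 * η) + 37500 * η) * lenThreshold n q ((b : ℝ) - a) ((c : ℝ) - b) := by
        ring
    _ ≤ (1 + 2 * ξ) * lenThreshold n q ((b : ℝ) - a) ((c : ℝ) - b) := by
        refine mul_le_mul_of_nonneg_right ?_ (by linarith)
        nlinarith

end Grid

section PartialSum

variable {n a b c : ℕ} {q M : ℝ} {v : EuclideanSpace ℝ (Fin n)}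

/-- The sum of the first `k` coordinates of a vector. -/
noncomputable def partialSum (v : EuclideanSpace ℝ (Fin n)) (k : ℕ) : ℝ :=
  ∑ i ∈ Finset.Ico 1 (k + 1), coord v i

lemma partialSum_sub (v : EuclideanSpace ℝ (Fin n)) (hab : a ≤ b) :
    partialSum v b - partialSum v a = ∑ i ∈ Finset.Ico (a + 1) (b + 1), coord v i := by
  unfold partialSum
  rw [sub_eq_iff_eq_add', Finset.sum_Ico_consecutive _ (by omega) (by omega)]

lemma norm_segInd_sq (ha : 1 ≤ a) (hab : a ≤ b) (hb : b ≤ n + 1) :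
    ‖segInd n a b‖ ^ 2 = (b : ℝ) - a := by
  have hcoord : ∀ k ∈ Finset.Ico a b, coord (segInd n a b) k = 1 := by
    intro k hk
    have hk' := Finset.mem_Ico.1 hk
    rw [coord, dif_pos ⟨by omega, by omega⟩]
    simp [segInd, Nat.sub_add_cancel (ha.trans hk'.1), hk']
  rw [← real_inner_self_eq_norm_sq, inner_segInd _ ha hb, Finset.sum_congr rfl hcoord,
    Finset.sum_const, Nat.card_Ico, nsmul_one, Nat.cast_sub hab]

lemma contrast_sq_eq_splitGain (v : EuclideanSpace ℝ (Fin n))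
    (h : IsTriad n (a + 1) (b + 1) (c + 1)) :
    contrast v (a + 1) (b + 1) (c + 1) ^ 2 = splitGain (partialSum v) a b c := by
  have hab : a < b := Nat.lt_of_succ_lt_succ h.left_lt
  have hbc : b < c := Nat.lt_of_succ_lt_succ h.lt_right
  rw [h.contrast_sq, segMean, segMean, ← partialSum_sub v hab.le, ← partialSum_sub v hbc.le,
    splitGain]
  push_cast
  simp only [add_sub_add_right_eq_sub]
  have hu := natCast_sub_pos hab
  have hv := natCast_sub_pos hbc
  rw [← sub_add_sub_cancel' (b : ℝ) a c, ← sub_add_sub_cancel (partialSum v c) (partialSum v b)]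
  set u := (b : ℝ) - a
  set w := (c : ℝ) - b
  field_simp
  ring

lemma contrastsBounded_of_splitGain_le
    (h : ∀ a b c : ℕ, a < b → b < c → c ≤ n →
      splitGain (partialSum v) a b c ≤ M * lenThreshold n q ((b : ℝ) - a) ((c : ℝ) - b)) :
    ContrastsBounded M q v := by
  intro a b c htri
  obtain ⟨ha, hab, hbc, hc⟩ := htri
  obtain ⟨a, rfl⟩ := Nat.exists_eq_add_of_le' ha
  obtain ⟨b, rfl⟩ := Nat.exists_eq_add_of_le' (ha.trans hab.le)
  obtain ⟨c, rfl⟩ := Nat.exists_eq_add_of_le' (ha.trans (hab.trans hbc).le)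
  rw [contrast_sq_eq_splitGain v ⟨ha, hab, hbc, hc⟩, sqThreshold_eq_lenThreshold]
  push_cast
  simp only [add_sub_add_right_eq_sub]
  exact h a b c (by omega) (by omega) (by omega)

end PartialSum

section Noise

variable {Ω : Type*} [MeasurableSpace Ω] {P : Measure Ω} {n : ℕ} {ε : Fin n → Ω → ℝ}

/-- The noise as a random vector. -/
noncomputable def noiseVec {Ω : Type*} {n : ℕ} (ε : Fin n → Ω → ℝ) (ω : Ω) :
    EuclideanSpace ℝ (Fin n) :=
  WithLp.toLp 2 fun i => ε i ω

lemma inner_noiseVec {Ω : Type*} (ε : Fin n → Ω → ℝ) (u : EuclideanSpace ℝ (Fin n)) (ω : Ω) :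
    inner ℝ u (noiseVec ε ω) = ∑ i, u i * ε i ω := by
  simp [PiLp.inner_apply, noiseVec, mul_comm]

lemma IsNoise.hasSubgaussianMGF_inner (hε : IsNoise ε P) (u : EuclideanSpace ℝ (Fin n)) :
    HasSubgaussianMGF (fun ω => inner ℝ u (noiseVec ε ω)) (‖u‖₊ ^ 2) P := by
  have hind : iIndepFun (fun i => fun ω => u i * ε i ω) P :=
    hε.indep.comp (fun i y => u i * y) fun i => measurable_const_mul (u i)
  have hsum := HasSubgaussianMGF.sum_of_iIndepFun (s := Finset.univ) hind
    fun i _ => (hε.subgaussian i).const_mul (u i)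
  convert hsum using 1
  · simp only [inner_noiseVec]
  · rw [← NNReal.coe_inj]
    push_cast
    rw [EuclideanSpace.real_norm_sq_eq]
    exact Finset.sum_congr rfl fun i _ => (mul_one _).symm

lemma IsNoise.measureReal_norm_sq_mul_lt_inner_sq_le [IsProbabilityMeasure P] (hε : IsNoise ε P)
    {u : EuclideanSpace ℝ (Fin n)} (hu : u ≠ 0) {x : ℝ} (hx : 0 ≤ x) :
    P.real {ω | ‖u‖ ^ 2 * x < inner ℝ u (noiseVec ε ω) ^ 2} ≤ 2 * Real.exp (-x / 2) := by
  have : ‖u‖ ≠ 0 := norm_ne_zero_iff.2 hu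
  have hsub := hε.hasSubgaussianMGF_inner u
  set X := fun ω => inner ℝ u (noiseVec ε ω)
  have hupper := hsub.measure_ge_le (Real.sqrt_nonneg (‖u‖ ^ 2 * x))
  have hlower := hsub.neg.measure_ge_le (Real.sqrt_nonneg (‖u‖ ^ 2 * x))
  have hexp : -√(‖u‖ ^ 2 * x) ^ 2 / (2 * (‖u‖₊ ^ 2 : NNReal)) = -x / 2 := by
    rw [Real.sq_sqrt (by positivity), NNReal.coe_pow, coe_nnnorm]
    field_simp
  rw [hexp] at hupper hlower
  have hincl : {ω | ‖u‖ ^ 2 * x < X ω ^ 2}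
      ⊆ {ω | √(‖u‖ ^ 2 * x) ≤ X ω} ∪ {ω | √(‖u‖ ^ 2 * x) ≤ (-X) ω} := fun ω hω =>
    le_abs.1 (Real.sqrt_le_iff.2 ⟨abs_nonneg _, (sq_abs (X ω)).symm ▸ hω.le⟩)
  calc P.real {ω | ‖u‖ ^ 2 * x < X ω ^ 2}
      ≤ P.real {ω | √(‖u‖ ^ 2 * x) ≤ X ω} + P.real {ω | √(‖u‖ ^ 2 * x) ≤ (-X) ω} :=
        (measureReal_mono hincl).trans (measureReal_union_le _ _)
    _ ≤ 2 * Real.exp (-x / 2) := by linarith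

lemma IsNoise.measureReal_lt_splitGain_le [IsProbabilityMeasure P] (hε : IsNoise ε P) {x : ℝ}
    (hx : 0 ≤ x) {a b c : ℕ} (hab : a < b) (hbc : b < c) (hc : c ≤ n) :
    P.real {ω | x < splitGain (partialSum (noiseVec ε ω)) a b c} ≤ 2 * Real.exp (-x / 2) := by
  have htri : IsTriad n (a + 1) (b + 1) (c + 1) :=
    ⟨by omega, by omega, by omega, by omega⟩
  have hnorm := htri.norm_splitVec
  have htail := hε.measureReal_norm_sq_mul_lt_inner_sq_le
    (norm_ne_zero_iff.1 (hnorm.trans_ne one_ne_zero)) hx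
  simpa only [hnorm, one_pow, one_mul, htri.inner_splitVec, contrast_sq_eq_splitGain _ htri]
    using htail

lemma IsNoise.measureReal_lt_partialSum_sub_sq_le [IsProbabilityMeasure P] (hε : IsNoise ε P)
    {x : ℝ} (hx : 0 ≤ x) {a b : ℕ} (hab : a < b) (hb : b ≤ n) :
    P.real {ω | ((b : ℝ) - a) * x
        < (partialSum (noiseVec ε ω) b - partialSum (noiseVec ε ω) a) ^ 2}
      ≤ 2 * Real.exp (-x / 2) := by
  have hnorm : ‖segInd n (a + 1) (b + 1)‖ ^ 2 = (b : ℝ) - a := by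
    rw [norm_segInd_sq (by omega) (by omega) (by omega)]
    push_cast
    ring
  have hne : segInd n (a + 1) (b + 1) ≠ 0 := by
    rw [← norm_ne_zero_iff, ← sq_pos_iff, hnorm]
    exact natCast_sub_pos hab
  have htail := hε.measureReal_norm_sq_mul_lt_inner_sq_le hne hx
  simpa only [hnorm, inner_segInd _ (Nat.le_add_left 1 a) (Nat.succ_le_succ hb),
    ← partialSum_sub _ hab.le] using htail

end Noise

section DyadicTail

variable {Ω : Type*} [MeasurableSpace Ω] {P : Measure Ω} {n : ℕ} {ε : Fin n → Ω → ℝ} {q : ℝ}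

lemma exists_four_mul_logScale_lt_of_not_dyadicBounded {S : ℕ → ℝ} (hq : 0 ≤ q)
    (h : ¬ DyadicBounded S n q) :
    ∃ j ∈ Finset.range (Nat.log 2 n + 1), ∃ β ∈ Finset.range (n / 2 ^ j),
      4 * logScale n q (2 ^ j) < (S ((β + 1) * 2 ^ j) - S (β * 2 ^ j)) ^ 2 := by
  simp only [DyadicBounded, not_forall, not_le] at h
  obtain ⟨j, β, hβ, hlt⟩ := h
  have hj : 2 ^ j ≤ n := (Nat.le_mul_of_pos_left _ β.succ_pos).trans hβ
  refine ⟨j, Finset.mem_range.2 (Nat.lt_succ_of_le (Nat.le_log_of_pow_le one_lt_two hj)), β,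
    Finset.mem_range.2 ((Nat.le_div_iff_mul_le (by positivity)).2 hβ), ?_⟩
  have hscale : 0 ≤ logScale n q (2 ^ j) :=
    logScale_nonneg hq (by positivity) (by exact_mod_cast hj)
  calc 4 * logScale n q (2 ^ j) = (2 * √(logScale n q (2 ^ j))) ^ 2 := by
        rw [mul_pow, Real.sq_sqrt hscale]
        norm_num
    _ < |S ((β + 1) * 2 ^ j) - S (β * 2 ^ j)| ^ 2 := by gcongr
    _ = (S ((β + 1) * 2 ^ j) - S (β * 2 ^ j)) ^ 2 := sq_abs _

lemma IsNoise.measureReal_four_mul_logScale_lt_le [IsProbabilityMeasure P] (hε : IsNoise ε P)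
    (hq : 0 ≤ q) {j β : ℕ} (hβ : (β + 1) * 2 ^ j ≤ n) :
    P.real {ω | 4 * logScale n q (2 ^ j) < (partialSum (noiseVec ε ω) ((β + 1) * 2 ^ j)
        - partialSum (noiseVec ε ω) (β * 2 ^ j)) ^ 2}
      ≤ 2 * Real.exp (-(2 * q)) * (2 ^ j / n) ^ 2 := by
  have hj : 2 ^ j ≤ n := (Nat.le_mul_of_pos_left _ β.succ_pos).trans hβ
  have hjn : (2 : ℝ) ^ j ≤ n := by exact_mod_cast hj
  have hn : (0 : ℝ) < n := lt_of_lt_of_le (by positivity) hjn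
  have hlog : 0 ≤ Real.log ((n : ℝ) / 2 ^ j) :=
    Real.log_nonneg ((one_le_div (by positivity)).2 hjn)
  have htail := hε.measureReal_lt_partialSum_sub_sq_le
    (x := 4 * (q + Real.log ((n : ℝ) / 2 ^ j))) (by positivity)
    (Nat.mul_lt_mul_of_pos_right β.lt_succ_self (Nat.two_pow_pos j)) hβ
  have hlevel : (((β + 1) * 2 ^ j : ℕ) - (β * 2 ^ j : ℕ) : ℝ)
      * (4 * (q + Real.log ((n : ℝ) / 2 ^ j))) = 4 * logScale n q (2 ^ j) := by
    rw [logScale]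
    push_cast
    ring
  have hexp : Real.exp (-(4 * (q + Real.log ((n : ℝ) / 2 ^ j))) / 2)
      = Real.exp (-(2 * q)) * (2 ^ j / n) ^ 2 := by
    rw [show -(4 * (q + Real.log ((n : ℝ) / 2 ^ j))) / 2
      = -(2 * q) + (2 : ℕ) * -Real.log ((n : ℝ) / 2 ^ j) by push_cast; ring, Real.exp_add,
      Real.exp_nat_mul, Real.exp_neg (Real.log _), Real.exp_log (by positivity), inv_div]
  rwa [hlevel, hexp, ← mul_assoc] at htail

lemma sum_range_log_two_pow_le (hn : 1 ≤ n) :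
    ∑ j ∈ Finset.range (Nat.log 2 n + 1), (2 : ℝ) ^ j ≤ 2 * n := by
  have hlog : (2 : ℝ) ^ Nat.log 2 n ≤ n := by
    exact_mod_cast Nat.pow_log_le_self 2 (Nat.one_le_iff_ne_zero.1 hn)
  rw [geom_sum_eq (by norm_num), pow_succ]
  linarith

lemma IsNoise.measureReal_not_dyadicBounded_le [IsProbabilityMeasure P] (hε : IsNoise ε P)
    (hn : 1 ≤ n) (hq : 0 ≤ q) :
    P.real {ω | ¬ DyadicBounded (partialSum (noiseVec ε ω)) n q} ≤ 4 * Real.exp (-(2 * q)) := by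
  have : (0 : ℝ) < n := Nat.cast_pos.2 hn
  set bad : ℕ → ℕ → Set Ω := fun j β => {ω | 4 * logScale n q (2 ^ j)
    < (partialSum (noiseVec ε ω) ((β + 1) * 2 ^ j)
        - partialSum (noiseVec ε ω) (β * 2 ^ j)) ^ 2}
  have hincl : {ω | ¬ DyadicBounded (partialSum (noiseVec ε ω)) n q}
      ⊆ ⋃ j ∈ Finset.range (Nat.log 2 n + 1), ⋃ β ∈ Finset.range (n / 2 ^ j), bad j β := by
    intro ω hω
    obtain ⟨j, hj, β, hβ, hlt⟩ := exists_four_mul_logScale_lt_of_not_dyadicBounded hq hω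
    exact Set.mem_biUnion hj (Set.mem_biUnion hβ hlt)
  have hblocks : ∀ j, P.real (⋃ β ∈ Finset.range (n / 2 ^ j), bad j β)
      ≤ 2 * Real.exp (-(2 * q)) / n * 2 ^ j := by
    intro j
    have hcard : ((n / 2 ^ j : ℕ) : ℝ) ≤ n / 2 ^ j := by exact_mod_cast Nat.cast_div_le
    calc P.real (⋃ β ∈ Finset.range (n / 2 ^ j), bad j β)
        ≤ ∑ β ∈ Finset.range (n / 2 ^ j), P.real (bad j β) := measureReal_biUnion_finset_le _ _
      _ ≤ ∑ β ∈ Finset.range (n / 2 ^ j), 2 * Real.exp (-(2 * q)) * (2 ^ j / n) ^ 2 := by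
          refine Finset.sum_le_sum fun β hβ => hε.measureReal_four_mul_logScale_lt_le hq ?_
          exact (Nat.le_div_iff_mul_le (by positivity)).1 (Finset.mem_range.1 hβ)
      _ = (n / 2 ^ j : ℕ) * (2 * Real.exp (-(2 * q)) * (2 ^ j / n) ^ 2) := by
          rw [Finset.sum_const, Finset.card_range, nsmul_eq_mul]
      _ ≤ n / 2 ^ j * (2 * Real.exp (-(2 * q)) * (2 ^ j / n) ^ 2) := by gcongr
      _ = 2 * Real.exp (-(2 * q)) / n * 2 ^ j := by field_simp
  calc P.real {ω | ¬ DyadicBounded (partialSum (noiseVec ε ω)) n q}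
      ≤ ∑ j ∈ Finset.range (Nat.log 2 n + 1), 2 * Real.exp (-(2 * q)) / n * 2 ^ j :=
        (measureReal_mono hincl (measure_ne_top P _)).trans
          ((measureReal_biUnion_finset_le _ _).trans (Finset.sum_le_sum fun j _ => hblocks j))
    _ ≤ 2 * Real.exp (-(2 * q)) / n * (2 * n) := by
        rw [← Finset.mul_sum]
        gcongr
        exact sum_range_log_two_pow_le hn
    _ = 4 * Real.exp (-(2 * q)) := by field_simp; norm_num

end DyadicTail

section GridTail

variable {n k i j J : ℕ} {q u v ξ : ℝ}

lemma log_div_two_pow_le_lenThreshold (hu : 0 < u) (hv : 0 < v) (hn : u + v ≤ n)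
    (hi : u ≤ 2 ^ (i + 2)) (hj : v ≤ 2 ^ (j + 2)) :
    q + 2 * (Real.log (n / 2 ^ min i j) - Real.log 4) ≤ lenThreshold n q u v := by
  have hn0 : (0 : ℝ) < n := by linarith
  have hside : ∀ {m : ℕ} {x y : ℝ}, 0 < x → 0 < y → x ≤ 2 ^ (m + 2) →
      q + 2 * (Real.log (n / 2 ^ m) - Real.log 4) ≤ lenThreshold n q x y := by
    intro m x y hx hy hxm
    have hlog : Real.log ((n : ℝ) / 2 ^ m) - Real.log 4 ≤ Real.log (n / x) := by
      rw [← Real.log_div (by positivity) (by norm_num), div_div]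
      refine Real.log_le_log (by positivity) (div_le_div_of_nonneg_left hn0.le hx ?_)
      exact hxm.trans_eq (by rw [pow_add]; norm_num)
    linarith [le_lenThreshold (q := q) hx hy hn0]
  rcases min_choice i j with h | h <;> rw [h]
  · exact hside hu hv hi
  · exact lenThreshold_comm (n : ℝ) q u v ▸ hside hv hu hj

lemma scale_gap_le_log (hi : i ≤ J) (hj : j ≤ J) (hJ : 2 ^ J ≤ n) :
    (((J - i : ℕ) : ℝ) + (J - j : ℕ)) / 4 ≤ Real.log (n / 2 ^ min i j) := by
  have hm : min i j ≤ J := (min_le_left i j).trans hi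
  have hgap : ((J - i : ℕ) : ℝ) + (J - j : ℕ) ≤ 2 * (J - min i j : ℕ) := by
    exact_mod_cast (show J - i + (J - j) ≤ 2 * (J - min i j) by omega)
  have hpow : ((J - min i j : ℕ) : ℝ) * Real.log 2 ≤ Real.log (n / 2 ^ min i j) := by
    rw [← Real.log_pow]
    refine Real.log_le_log (by positivity) ?_
    rw [le_div_iff₀ (by positivity), ← pow_add, Nat.sub_add_cancel hm]
    exact_mod_cast hJ
  nlinarith [Real.log_two_gt_d9, Nat.cast_nonneg (α := ℝ) (J - min i j)]

lemma exp_neg_mul_lenThreshold_le (hq : 0 ≤ q) (hξ : 0 ≤ ξ) (hξ1 : ξ ≤ 1) (hu : 0 < u) (hv : 0 < v)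
    (hn : u + v ≤ n) (hui : u ≤ 2 ^ (i + 2)) (hvj : v ≤ 2 ^ (j + 2)) (hi : i ≤ J) (hj : j ≤ J)
    (hJ : 2 ^ J ≤ n) :
    Real.exp (-((1 + ξ) * lenThreshold n q u v) / 2)
      ≤ 16 * Real.exp (-(q / 2)) * (2 ^ min i j / n) * Real.exp (-(ξ / 4)) ^ (J - i)
        * Real.exp (-(ξ / 4)) ^ (J - j) := by
  have hn0 : (0 : ℝ) < n := by linarith
  have hlog4 : 0 ≤ Real.log 4 := Real.log_nonneg (by norm_num)
  have hthr := log_div_two_pow_le_lenThreshold (q := q) hu hv hn hui hvj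
  have hgap := mul_le_mul_of_nonneg_left (scale_gap_le_log hi hj hJ) hξ
  have hexp : -((1 + ξ) * lenThreshold n q u v) / 2
      ≤ Real.log 16 + -(q / 2) + -Real.log ((n : ℝ) / 2 ^ min i j)
        + (J - i : ℕ) * -(ξ / 4) + (J - j : ℕ) * -(ξ / 4) := by
    rw [show (16 : ℝ) = 4 ^ 2 by norm_num, Real.log_pow]
    push_cast
    linarith [mul_le_mul_of_nonneg_left hthr (by linarith : 0 ≤ 1 + ξ), mul_nonneg hξ hq,
      mul_le_mul_of_nonneg_right hξ1 hlog4]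
  refine (Real.exp_le_exp.2 hexp).trans_eq ?_
  rw [Real.exp_add, Real.exp_add, Real.exp_add, Real.exp_add, Real.exp_log (by norm_num),
    Real.exp_neg (Real.log _), Real.exp_log (by positivity), Real.exp_nat_mul, Real.exp_nat_mul,
    inv_div]

lemma sum_exp_neg_pow_sub_le (hξ : 0 < ξ) (hξ1 : ξ ≤ 1) (J : ℕ) :
    ∑ i ∈ Finset.range (J + 1), Real.exp (-(ξ / 4)) ^ (J - i) ≤ 8 / ξ := by
  have hy1 : Real.exp (-(ξ / 4)) < 1 := Real.exp_lt_one_iff.2 (by linarith)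
  have hgap : ξ / 8 ≤ 1 - Real.exp (-(ξ / 4)) := by
    have hinv : Real.exp (-(ξ / 4)) ≤ (ξ / 4 + 1)⁻¹ := by
      rw [Real.exp_neg]
      exact inv_anti₀ (by linarith) (Real.add_one_le_exp _)
    have hlin : (ξ / 4 + 1)⁻¹ ≤ 1 - ξ / 8 := by
      rw [inv_le_iff_one_le_mul₀ (by linarith)]
      nlinarith
    linarith
  calc ∑ i ∈ Finset.range (J + 1), Real.exp (-(ξ / 4)) ^ (J - i)
      = ∑ i ∈ Finset.range (J + 1), Real.exp (-(ξ / 4)) ^ i :=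
        Finset.sum_range_reflect (fun i => Real.exp (-(ξ / 4)) ^ i) (J + 1)
    _ ≤ ∑' i, Real.exp (-(ξ / 4)) ^ i :=
        (summable_geometric_of_lt_one (Real.exp_pos _).le hy1).sum_le_tsum _ fun i _ =>
          (pow_pos (Real.exp_pos _) i).le
    _ = (1 - Real.exp (-(ξ / 4)))⁻¹ := tsum_geometric_of_lt_one (Real.exp_pos _).le hy1
    _ ≤ (ξ / 8)⁻¹ := inv_anti₀ (by positivity) hgap
    _ = 8 / ξ := inv_div _ _

lemma two_pow_le_mesh_mul (k j : ℕ) : 2 ^ j ≤ mesh k j * 4 ^ k := by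
  rw [mesh, show 4 = 2 ^ 2 by rfl, ← pow_mul, ← pow_add]
  exact Nat.pow_le_pow_right two_pos (by omega)

lemma two_pow_add_two_le_mesh_mul (k j : ℕ) : 2 ^ (j + 2) ≤ mesh k j * 4 ^ (k + 1) := by
  rw [pow_add, pow_succ 4, ← mul_assoc]
  exact Nat.mul_le_mul_right 4 (two_pow_le_mesh_mul k j)

/-- The integer coordinates of a triple of `gridTriples n k i j`: the index of its middle point in
the finer of the two meshes, and the numbers of mesh steps to its left and to its right. Counting
grid triples amounts to counting these coordinates. -/
def gridCoords (k i j : ℕ) (t : ℕ × ℕ × ℕ) : ℕ × ℕ × ℕ :=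
  (t.2.1 / mesh k (min i j), t.2.1 / mesh k i - t.1 / mesh k i, t.2.2 / mesh k j - t.2.1 / mesh k j)

lemma gridCoords_mem {t : ℕ × ℕ × ℕ} (ht : t ∈ gridTriples n k i j) :
    gridCoords k i j t ∈ Finset.range (n / mesh k (min i j) + 1) ×ˢ Finset.range (4 ^ (k + 1))
      ×ˢ Finset.Ioc 0 (4 ^ (k + 1)) := by
  obtain ⟨a, b, c⟩ := t
  obtain ⟨hc, ⟨⟨α, rfl⟩, -, ⟨γ, rfl⟩⟩, ⟨-, hba⟩, hbc, hcb⟩ := mem_gridTriples.1 ht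
  have hmi := mesh_pos k i
  have hmj := mesh_pos k j
  have hleft : b / mesh k i < α + 4 ^ (k + 1) := by
    refine Nat.div_lt_of_lt_mul (hba.trans_le ?_)
    rw [mul_add]
    exact Nat.add_le_add_left (two_pow_add_two_le_mesh_mul k i) _
  have hright : γ ≤ b / mesh k j + 4 ^ (k + 1) := by
    rw [← Nat.add_mul_div_left _ _ hmj, Nat.le_div_iff_mul_le hmj, mul_comm]
    exact hcb.le.trans (Nat.add_le_add_left (two_pow_add_two_le_mesh_mul k j) _)
  have hright' : b / mesh k j < γ := Nat.div_lt_of_lt_mul hbc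
  have hmid : b / mesh k (min i j) ≤ n / mesh k (min i j) :=
    Nat.div_le_div_right (hbc.le.trans hc)
  simp only [gridCoords, Finset.mem_product, Finset.mem_range, Finset.mem_Ioc,
    Nat.mul_div_cancel_left _ hmi, Nat.mul_div_cancel_left _ hmj]
  omega

lemma gridCoords_injOn (n k i j : ℕ) : Set.InjOn (gridCoords k i j) (gridTriples n k i j) := by
  rintro ⟨a, b, c⟩ ht ⟨a', b', c'⟩ ht' heq
  obtain ⟨-, ⟨⟨α, rfl⟩, hb, ⟨γ, rfl⟩⟩, ⟨hab, -⟩, hbc, -⟩ := mem_gridTriples.1 ht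
  obtain ⟨-, ⟨⟨α', rfl⟩, hb', ⟨γ', rfl⟩⟩, ⟨hab', -⟩, hbc', -⟩ := mem_gridTriples.1 ht'
  have hmi := mesh_pos k i
  simp only [gridCoords, Prod.mk.injEq, Nat.mul_div_cancel_left _ hmi,
    Nat.mul_div_cancel_left _ (mesh_pos k j)] at heq
  obtain ⟨hmid, hleft, hright⟩ := heq
  obtain rfl : b = b' := (Nat.div_left_inj hb hb').1 hmid
  have hα : α ≤ b / mesh k i := (Nat.le_div_iff_mul_le hmi).2 (by linarith)
  have hα' : α' ≤ b / mesh k i := (Nat.le_div_iff_mul_le hmi).2 (by linarith)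
  have hγ : b / mesh k j < γ := Nat.div_lt_of_lt_mul hbc
  have hγ' : b / mesh k j < γ' := Nat.div_lt_of_lt_mul hbc'
  obtain rfl : α = α' := by omega
  obtain rfl : γ = γ' := by omega
  rfl

lemma card_gridTriples_le (n k i j : ℕ) :
    (gridTriples n k i j).card ≤ (n / mesh k (min i j) + 1) * (4 ^ (k + 1) * 4 ^ (k + 1)) :=
  (Finset.card_le_card_of_injOn _ (fun _ ht => gridCoords_mem ht)
    (gridCoords_injOn n k i j)).trans_eq (by
      simp only [Finset.card_product, Finset.card_range, Nat.card_Ioc, Nat.sub_zero])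

lemma card_gridTriples_mul_le (k : ℕ) (hn : 2 ^ min i j ≤ n) :
    ((gridTriples n k i j).card : ℝ) * (2 ^ min i j / n) ≤ 32 * 64 ^ k := by
  set m := min i j
  have hn0 : (0 : ℝ) < n := Nat.cast_pos.2 ((Nat.two_pow_pos m).trans_le hn)
  have hmesh : (0 : ℝ) < mesh k m := Nat.cast_pos.2 (mesh_pos k m)
  have hmeshn : mesh k m ≤ n := (Nat.pow_le_pow_right two_pos (Nat.sub_le _ _)).trans hn
  have hpoints : ((n / mesh k m : ℕ) : ℝ) + 1 ≤ 2 * (n / mesh k m) := by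
    have hone : (1 : ℝ) ≤ n / mesh k m := (one_le_div hmesh).2 (Nat.cast_le.2 hmeshn)
    have hfloor : ((n / mesh k m : ℕ) : ℝ) ≤ n / mesh k m := Nat.cast_div_le
    linarith
  have hcard : ((gridTriples n k i j).card : ℝ)
      ≤ 2 * (n / mesh k m) * (4 ^ (k + 1) * 4 ^ (k + 1)) :=
    calc ((gridTriples n k i j).card : ℝ)
        ≤ (((n / mesh k m : ℕ) : ℝ) + 1) * (4 ^ (k + 1) * 4 ^ (k + 1)) := by
          exact_mod_cast card_gridTriples_le n k i j
      _ ≤ 2 * (n / mesh k m) * (4 ^ (k + 1) * 4 ^ (k + 1)) := by gcongr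
  have hscale : (2 : ℝ) ^ m ≤ mesh k m * 4 ^ k := by exact_mod_cast two_pow_le_mesh_mul k m
  calc ((gridTriples n k i j).card : ℝ) * (2 ^ m / n)
      ≤ 2 * (n / mesh k m) * (4 ^ (k + 1) * 4 ^ (k + 1)) * (mesh k m * 4 ^ k / n) := by gcongr
    _ = 32 * (4 ^ k * 4 ^ k * 4 ^ k) := by
        field_simp
        ring
    _ = 32 * 64 ^ k := by
        rw [← mul_pow, ← mul_pow]
        norm_num

variable {Ω : Type*} [MeasurableSpace Ω] {P : Measure Ω} {ε : Fin n → Ω → ℝ}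

lemma IsNoise.measureReal_grid_lt_splitGain_le [IsProbabilityMeasure P] (hε : IsNoise ε P)
    (hq : 0 ≤ q) (hξ : 0 ≤ ξ) (hξ1 : ξ ≤ 1) (hi : i ≤ J) (hj : j ≤ J) (hJ : 2 ^ J ≤ n)
    {t : ℕ × ℕ × ℕ} (ht : t ∈ gridTriples n k i j) :
    P.real {ω | (1 + ξ) * lenThreshold n q ((t.2.1 : ℝ) - t.1) ((t.2.2 : ℝ) - t.2.1)
        < splitGain (partialSum (noiseVec ε ω)) t.1 t.2.1 t.2.2}
      ≤ 32 * Real.exp (-(q / 2)) * (2 ^ min i j / n)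
        * (Real.exp (-(ξ / 4)) ^ (J - i) * Real.exp (-(ξ / 4)) ^ (J - j)) := by
  obtain ⟨a, b, c⟩ := t
  obtain ⟨hc, -, ⟨hab, hba⟩, hbc, hcb⟩ := mem_gridTriples.1 ht
  have hu := natCast_sub_pos hab
  have hv := natCast_sub_pos hbc
  have hn : (b : ℝ) - a + ((c : ℝ) - b) ≤ n := by
    rw [add_comm, sub_add_sub_cancel]
    exact natCast_sub_le hc
  have hui : (b : ℝ) - a ≤ 2 ^ (i + 2) := by
    rw [sub_le_iff_le_add']
    exact_mod_cast hba.le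
  have hvj : (c : ℝ) - b ≤ 2 ^ (j + 2) := by
    rw [sub_le_iff_le_add']
    exact_mod_cast hcb.le
  have hthr := hq.trans (le_lenThreshold_of_add_le (q := q) hu hv hn)
  have htail := hε.measureReal_lt_splitGain_le
    (mul_nonneg (by linarith : 0 ≤ 1 + ξ) hthr) hab hbc hc
  linarith [exp_neg_mul_lenThreshold_le hq hξ hξ1 hu hv hn hui hvj hi hj hJ]

lemma IsNoise.measureReal_grid_biUnion_le [IsProbabilityMeasure P] (hε : IsNoise ε P)
    (hq : 0 ≤ q) (hξ : 0 ≤ ξ) (hξ1 : ξ ≤ 1) (k : ℕ) (hi : i ≤ J) (hj : j ≤ J) (hJ : 2 ^ J ≤ n) :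
    P.real (⋃ t ∈ gridTriples n k i j,
        {ω | (1 + ξ) * lenThreshold n q ((t.2.1 : ℝ) - t.1) ((t.2.2 : ℝ) - t.2.1)
          < splitGain (partialSum (noiseVec ε ω)) t.1 t.2.1 t.2.2})
      ≤ 1024 * 64 ^ k * Real.exp (-(q / 2))
        * (Real.exp (-(ξ / 4)) ^ (J - i) * Real.exp (-(ξ / 4)) ^ (J - j)) := by
  have hscale : 2 ^ min i j ≤ n :=
    (Nat.pow_le_pow_right two_pos ((min_le_left i j).trans hi)).trans hJ
  set w := Real.exp (-(ξ / 4)) ^ (J - i) * Real.exp (-(ξ / 4)) ^ (J - j)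
  calc _ ≤ ∑ _t ∈ gridTriples n k i j, 32 * Real.exp (-(q / 2)) * (2 ^ min i j / n) * w :=
        (measureReal_biUnion_finset_le _ _).trans (Finset.sum_le_sum fun t ht =>
          hε.measureReal_grid_lt_splitGain_le hq hξ hξ1 hi hj hJ ht)
    _ = (gridTriples n k i j).card * (2 ^ min i j / n) * (32 * Real.exp (-(q / 2)) * w) := by
        rw [Finset.sum_const, nsmul_eq_mul]
        ring
    _ ≤ 32 * 64 ^ k * (32 * Real.exp (-(q / 2)) * w) := by
        exact mul_le_mul_of_nonneg_right (card_gridTriples_mul_le k hscale) (by positivity)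
    _ = 1024 * 64 ^ k * Real.exp (-(q / 2)) * w := by ring

lemma IsNoise.measureReal_not_gridBounded_le [IsProbabilityMeasure P] (hε : IsNoise ε P)
    (hn : 1 ≤ n) (k : ℕ) (hq : 0 ≤ q) (hξ : 0 < ξ) (hξ1 : ξ ≤ 1) :
    P.real {ω | ¬ GridBounded (partialSum (noiseVec ε ω)) n k q (1 + ξ)}
      ≤ 65536 * 64 ^ k / ξ ^ 2 * Real.exp (-(q / 2)) := by
  set J := Nat.log 2 n
  have hJn : 2 ^ J ≤ n := Nat.pow_log_le_self 2 (Nat.one_le_iff_ne_zero.1 hn)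
  set y := Real.exp (-(ξ / 4))
  have hincl : {ω | ¬ GridBounded (partialSum (noiseVec ε ω)) n k q (1 + ξ)}
      ⊆ ⋃ i ∈ Finset.range (J + 1), ⋃ j ∈ Finset.range (J + 1), ⋃ t ∈ gridTriples n k i j,
        {ω | (1 + ξ) * lenThreshold n q ((t.2.1 : ℝ) - t.1) ((t.2.2 : ℝ) - t.2.1)
          < splitGain (partialSum (noiseVec ε ω)) t.1 t.2.1 t.2.2} := by
    intro ω hω
    simp only [GridBounded, Set.mem_ofPred_eq, not_forall, not_le] at hω
    obtain ⟨i, hi, j, hj, t, ht, hlt⟩ := hω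
    exact Set.mem_biUnion hi (Set.mem_biUnion hj (Set.mem_biUnion ht hlt))
  calc P.real {ω | ¬ GridBounded (partialSum (noiseVec ε ω)) n k q (1 + ξ)}
      ≤ ∑ i ∈ Finset.range (J + 1), ∑ j ∈ Finset.range (J + 1),
          1024 * 64 ^ k * Real.exp (-(q / 2)) * (y ^ (J - i) * y ^ (J - j)) := by
        refine (measureReal_mono hincl (measure_ne_top P _)).trans
          ((measureReal_biUnion_finset_le _ _).trans (Finset.sum_le_sum fun i hi =>
            (measureReal_biUnion_finset_le _ _).trans (Finset.sum_le_sum fun j hj => ?_)))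
        exact hε.measureReal_grid_biUnion_le hq hξ.le hξ1 k
          (Nat.lt_succ_iff.1 (Finset.mem_range.1 hi))
          (Nat.lt_succ_iff.1 (Finset.mem_range.1 hj)) hJn
    _ = 1024 * 64 ^ k * Real.exp (-(q / 2)) * ((∑ i ∈ Finset.range (J + 1), y ^ (J - i))
          * ∑ j ∈ Finset.range (J + 1), y ^ (J - j)) := by
        rw [Finset.sum_mul_sum, Finset.mul_sum]
        exact Finset.sum_congr rfl fun i _ => (Finset.mul_sum _ _ _).symm
    _ ≤ 1024 * 64 ^ k * Real.exp (-(q / 2)) * ((8 / ξ) * (8 / ξ)) := by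
        have hsum := sum_exp_neg_pow_sub_le hξ hξ1 J
        gcongr
    _ = 65536 * 64 ^ k / ξ ^ 2 * Real.exp (-(q / 2)) := by
        field_simp
        ring

end GridTail

section DeviationEvent

variable {n : ℕ} {q ξ : ℝ}

lemma exists_precision (hξ : 0 < ξ) (hξ1 : ξ ≤ 1) :
    ∃ k : ℕ, 1 ≤ k ∧ 40000 * ((2 : ℝ) ^ k)⁻¹ ≤ ξ ∧ (2 : ℝ) ^ k ≤ 80000 / ξ := by
  obtain ⟨k, hlow, hup⟩ := exists_nat_pow_near (x := 40000 / ξ) (y := 2)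
    ((one_le_div hξ).2 (by linarith)) one_lt_two
  refine ⟨k + 1, k.succ_pos, ?_, ?_⟩
  · rw [← div_eq_mul_inv, div_le_iff₀ (by positivity), mul_comm]
    exact ((div_lt_iff₀ hξ).1 hup).le
  · calc (2 : ℝ) ^ (k + 1) = 2 ^ k * 2 := pow_succ _ _
      _ ≤ 40000 / ξ * 2 := by gcongr
      _ = 80000 / ξ := by ring

lemma log_le_mul_of_le_two_pow {x : ℝ} (hx : 0 < x) {m : ℕ} (hxm : x ≤ 2 ^ m) :
    Real.log x ≤ 0.7 * m :=
  calc Real.log x ≤ Real.log (2 ^ m) := Real.log_le_log hx hxm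
    _ = m * Real.log 2 := Real.log_pow _ _
    _ ≤ m * 0.7 := by
        gcongr
        linarith [Real.log_two_lt_d9]
    _ = 0.7 * m := mul_comm _ _

lemma log_inv_inv_sq_le {x : ℝ} (hξ : 0 < ξ) (hx : 0 < x) (hxξ : x ≤ 80000 / ξ)
    (hq : 24 + 2 * Real.log ξ⁻¹ ≤ q) : Real.log ((x⁻¹ ^ 2)⁻¹) ≤ q := by
  have hconst : Real.log 80000 ≤ 0.7 * (17 : ℕ) :=
    log_le_mul_of_le_two_pow (by norm_num) (by norm_num)
  have hlog : Real.log x ≤ Real.log 80000 + Real.log ξ⁻¹ := by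
    rw [← Real.log_mul (by norm_num) (by positivity), ← div_eq_mul_inv]
    exact Real.log_le_log hx hxξ
  rw [inv_pow, inv_inv, Real.log_pow]
  push_cast at hconst ⊢
  linarith

/-- The number of grid triples is polynomial in `ξ⁻¹`, which half of the exponent absorbs. -/
lemma sixtyFour_pow_div_sq_mul_exp_le {k : ℕ} (hξ : 0 < ξ) (hk : (2 : ℝ) ^ k ≤ 80000 / ξ)
    (hq : 32 * Real.log ξ⁻¹ ≤ q) :
    65536 * 64 ^ k / ξ ^ 2 * Real.exp (-(q / 2)) ≤ 65536 * 80000 ^ 6 * Real.exp (-(1 / 4 * q)) := by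
  have habsorb : ξ⁻¹ ^ 8 ≤ Real.exp (1 / 4 * q) := by
    rw [← Real.exp_log (inv_pos.2 hξ), ← Real.exp_nat_mul]
    refine Real.exp_le_exp.2 ?_
    push_cast
    linarith
  calc 65536 * 64 ^ k / ξ ^ 2 * Real.exp (-(q / 2))
      = 65536 * (2 ^ k) ^ 6 / ξ ^ 2 * Real.exp (-(q / 2)) := by
        rw [← pow_mul, mul_comm k, pow_mul]
        norm_num
    _ ≤ 65536 * (80000 / ξ) ^ 6 / ξ ^ 2 * Real.exp (-(q / 2)) := by gcongr
    _ = 65536 * 80000 ^ 6 * (ξ⁻¹ ^ 8 * Real.exp (-(q / 2))) := by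
        field_simp
    _ ≤ 65536 * 80000 ^ 6 * (Real.exp (1 / 4 * q) * Real.exp (-(q / 2))) := by gcongr
    _ = 65536 * 80000 ^ 6 * Real.exp (-(1 / 4 * q)) := by
        rw [← Real.exp_add]
        ring_nf

variable {Ω : Type*} [MeasurableSpace Ω] {P : Measure Ω} {ε : Fin n → Ω → ℝ}

lemma IsNoise.measurableSet_contrastsBounded (hε : IsNoise ε P) (M q : ℝ) :
    MeasurableSet {ω | ContrastsBounded M q (noiseVec ε ω)} := by
  simp only [ContrastsBounded, Set.ofPred_forall]
  refine MeasurableSet.iInter fun a => MeasurableSet.iInter fun b => MeasurableSet.iInter fun c =>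
    MeasurableSet.iInter fun htri => ?_
  simp only [← htri.inner_splitVec, inner_noiseVec]
  exact measurableSet_le
    ((Finset.measurable_sum _ fun i _ => (hε.measurable i).const_mul _).pow_const 2)
    measurable_const

lemma IsNoise.measureReal_contrastsBounded_ge [IsProbabilityMeasure P] (hε : IsNoise ε P)
    (hn : 1 ≤ n) (hξ : 0 < ξ) (hξ1 : ξ ≤ 1) (hq : 30 + 32 * Real.log ξ⁻¹ ≤ q) :
    1 - (65536 * 80000 ^ 6 + 4) * Real.exp (-(1 / 4 * q))
      ≤ P.real {ω | ContrastsBounded (1 + 2 * ξ) q (noiseVec ε ω)} := by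
  have hlog : 0 ≤ Real.log ξ⁻¹ := Real.log_nonneg ((one_le_inv₀ hξ).2 hξ1)
  have hq0 : 0 ≤ q := by linarith
  obtain ⟨k, hk1, hkξ, hk⟩ := exists_precision hξ hξ1
  have hkq := log_inv_inv_sq_le hξ (pow_pos two_pos k) hk (by linarith : _ ≤ q)
  have hincl : {ω | ContrastsBounded (1 + 2 * ξ) q (noiseVec ε ω)}ᶜ
      ⊆ {ω | ¬ DyadicBounded (partialSum (noiseVec ε ω)) n q}
        ∪ {ω | ¬ GridBounded (partialSum (noiseVec ε ω)) n k q (1 + ξ)} := by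
    refine Set.compl_subset_comm.1 fun ω hω => ?_
    simp only [Set.mem_compl_iff, Set.mem_union, Set.mem_ofPred_eq, not_or, not_not] at hω
    exact contrastsBounded_of_splitGain_le fun a b c hab hbc hc =>
      hω.2.splitGain_le (hω.1.incrementsBounded (by linarith)) (by linarith) hk1 hξ1 hkξ hkq
        hab hbc hc
  have hunion := (measureReal_mono (μ := P) hincl).trans (measureReal_union_le _ _)
  rw [probReal_compl_eq_one_sub (hε.measurableSet_contrastsBounded _ q)] at hunion
  have hdyadic : Real.exp (-(2 * q)) ≤ Real.exp (-(1 / 4 * q)) :=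
    Real.exp_le_exp.2 (by linarith)
  linarith [hε.measureReal_not_dyadicBounded_le hn hq0,
    hε.measureReal_not_gridBounded_le hn k hq0 hξ hξ1,
    sixtyFour_pow_div_sq_mul_exp_le hξ hk (by linarith : _ ≤ q)]

end DeviationEvent

section Precision

variable {L q : ℝ}

/-- The precision `ξ` of the deviation inequality of the noise for which `1 + 2ξ` stays below
`noiseRatio L ^ 2`. -/
noncomputable def noisePrecision (L : ℝ) : ℝ := (min L 2 - 1) / 25

lemma noisePrecision_pos (hL : 1 < L) : 0 < noisePrecision L :=
  div_pos (sub_pos.2 (lt_min hL one_lt_two)) (by norm_num)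

lemma noisePrecision_le (L : ℝ) : noisePrecision L ≤ 1 / 25 := by
  rw [noisePrecision]
  linarith [min_le_right L 2]

lemma one_add_two_mul_noisePrecision_le (hL : 1 < L) :
    1 + 2 * noisePrecision L ≤ noiseRatio L ^ 2 := by
  have hξ := noisePrecision_pos hL
  have hξL : 25 * noisePrecision L ≤ L - 1 := by
    rw [noisePrecision]
    linarith [min_le_left L 2]
  have hsqrt : 1 + 10 * noisePrecision L ≤ √L := by
    refine Real.le_sqrt_of_sq_le ?_
    nlinarith [noisePrecision_le L]
  have hratio : 1 + noisePrecision L ≤ noiseRatio L := by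
    rw [noiseRatio]
    linarith
  nlinarith

lemma log_inv_noisePrecision_le (hL : 1 < L)
    (hq : 150 + (65536 * 80000 ^ 6 + 4) * Real.log ((min L 2 - 1)⁻¹) < q) :
    30 + 32 * Real.log (noisePrecision L)⁻¹ ≤ q := by
  have hu : 0 < min L 2 - 1 := sub_pos.2 (lt_min hL one_lt_two)
  have hlog : 0 ≤ Real.log ((min L 2 - 1)⁻¹) :=
    Real.log_nonneg ((one_le_inv₀ hu).2 (by linarith [min_le_right L 2]))
  have hconst : Real.log 25 ≤ 0.7 * (5 : ℕ) := log_le_mul_of_le_two_pow (by norm_num) (by norm_num)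
  have hsplit : Real.log (noisePrecision L)⁻¹ = Real.log 25 + Real.log ((min L 2 - 1)⁻¹) := by
    rw [← Real.log_mul (by norm_num) (by positivity), noisePrecision, inv_div, div_eq_mul_inv]
  push_cast at hconst
  linarith

end Precision

end ChangePoint

theorem proposition9 :
    ∃ q₀ c₁ c₂ : ℝ, 0 < q₀ ∧ 0 < c₁ ∧ 0 < c₂ ∧
    ∀ L : ℝ, 1 < L →
    ∃ κ η : ℝ, 1 < κ ∧ 0 < η ∧ η < 1 ∧
    ∀ q : ℝ, q₀ + c₁ * Real.log ((min L 2 - 1)⁻¹) < q →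
    ∀ n : ℕ, 1 ≤ n →
    ∀ (Ω : Type*) [MeasurableSpace Ω] (P : MeasureTheory.Measure Ω)
      [MeasureTheory.IsProbabilityMeasure P] (ε : Fin n → Ω → ℝ), IsNoise ε P →
    ∃ A : Set Ω, MeasurableSet A ∧ 1 - c₁ * Real.exp (-(c₂ * q)) ≤ P.real A ∧
    ∀ (θ : EuclideanSpace ℝ (Fin n)) (ω : Ω), ω ∈ A →
    ∀ T : Finset ℕ, IsPLSE L q (observation θ ε ω) T →
      FewChangePoints θ η T ∧
      Detec θ κ q κ T ∧
      UnselectedLowEnergy θ (1.1 * Real.sqrt L + 0.9) q T := by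
  refine ⟨150, 65536 * 80000 ^ 6 + 4, 1 / 4, by norm_num, by norm_num, by norm_num,
    fun L hL => ⟨64 * L, endRatio L, by linarith, endRatio_pos hL,
      (endRatio_le hL).trans_lt (by norm_num), fun q hq n hn Ω _ P _ ε hε => ?_⟩⟩
  have hξ := noisePrecision_pos hL
  have hξ1 : noisePrecision L ≤ 1 := (noisePrecision_le L).trans (by norm_num)
  have hξq := log_inv_noisePrecision_le hL hq
  have hq3 : 3 ≤ q := by linarith [Real.log_nonneg ((one_le_inv₀ hξ).2 hξ1)]
  refine ⟨{ω | ContrastsBounded (1 + 2 * noisePrecision L) q (noiseVec ε ω)},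
    hε.measurableSet_contrastsBounded _ q, hε.measureReal_contrastsBounded_ge hn hξ hξ1 hξq,
    fun θ ω hω T hT => ?_⟩
  have hnoise : ContrastsBounded (noiseRatio L ^ 2) q (noiseVec ε ω) :=
    ContrastsBounded.mono hω (one_add_two_mul_noisePrecision_le hL) (by linarith)
  exact ⟨IsPLSE.fewChangePoints hT hn hL (by linarith) hnoise,
    IsPLSE.detec hT hL hq3 (hnoise.mono (noiseRatio_sq_lt hL).le (by linarith)),
    IsPLSE.unselectedLowEnergy hT (by linarith) (by linarith) hnoise⟩
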